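/- Work over $\mathbb{C}$. A Kummer surface is a quartic surface $S \subset \mathbb{P}^3$ whose singular locus consists of exactly $16$ ordinary double points. Such a surface is the quotient of an abelian surface $A$ by its standard involution $-\mathrm{id}_A$, with quotient map $\pi \colon A \to S$, and the embedding $S \subset \mathbb{P}^3$ determines a principal polarization $\theta \in \mathrm{NS}(A)$ such that $2\theta$ is the class of $\pi^* \mathcal{O}_S(1)$ in $\mathrm{NS}(A)$. Let $S, S' \subset \mathbb{P}^3$ be Kummer surfaces, with quotient maps $\pi \colon A \to S = A/(-\mathrm{id}_A)$ and $\pi' \colon A' \to S' = A'/(-\mathrm{id}_{A'})$ as above, and let $\theta \in \mathrm{NS}(A)$ and $\theta' \in \mathrm{NS}(A')$ be the principal polarizations such that $2\theta$ and $2\theta'$ are the classes of $\pi^* \mathcal{O}_S(1)$ and $\pi'^* \mathcal{O}_{S'}(1)$, respectively. If $(A, \theta)$ and $(A', \theta')$ are isomorphic as principally polarized abelian surfaces, then $S$ and $S'$ are projectively equivalent, that is, $f(S) = S'$ for some automorphism $f \colon \mathbb{P}^3 \to \mathbb{P}^3$. -/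

import Mathlib

open scoped LinearAlgebra.Projectivization Topology

namespace KummerSurface

/-! ### Hypersurfaces and Kummer surfaces in projective space over `ℂ` -/

/-- The projective space `ℙⁿ` over `ℂ`, as the set of lines through the origin in `ℂⁿ⁺¹`. -/
abbrev ProjSpace (n : ℕ) : Type := ℙ ℂ (Fin (n + 1) → ℂ)

/-- The zero locus in `ℙⁿ` of a homogeneous polynomial. -/
def zeroLocus {n : ℕ} (F : MvPolynomial (Fin (n + 1)) ℂ) : Set (ProjSpace n) :=
  {p | MvPolynomial.eval p.rep F = 0}

/-- The singular points of the hypersurface `F = 0` in `ℙⁿ`: the points of the hypersurface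
at which all first partial derivatives of the homogeneous polynomial `F` vanish. -/
def singularLocus {n : ℕ} (F : MvPolynomial (Fin (n + 1)) ℂ) : Set (ProjSpace n) :=
  {p | p ∈ zeroLocus F ∧ ∀ i, MvPolynomial.eval p.rep (MvPolynomial.pderiv i F) = 0}

/-- The `(n+1) × (n+1)` Hessian matrix of `F` at (a representative of) a point of `ℙⁿ`. -/
noncomputable def hessian {n : ℕ} (F : MvPolynomial (Fin (n + 1)) ℂ) (p : ProjSpace n) :
    Matrix (Fin (n + 1)) (Fin (n + 1)) ℂ :=
  Matrix.of fun i j =>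
    MvPolynomial.eval p.rep (MvPolynomial.pderiv i (MvPolynomial.pderiv j F))

/-- A singular point `p` of the hypersurface `F = 0` in `ℙⁿ` is an ordinary double point (node)
if the quadratic part of a local equation at `p` is a nondegenerate quadratic form in the `n`
local coordinates. At a singular point the homogeneous Hessian has the vector representing `p`
in its kernel, and it induces this quadratic form (up to the factor `2`) on the tangent space
`ℂⁿ⁺¹ / ℂp`; so the condition is that the Hessian has rank `n`. -/
def IsOrdinaryDoublePoint {n : ℕ} (F : MvPolynomial (Fin (n + 1)) ℂ) (p : ProjSpace n) : Prop :=
  p ∈ singularLocus F ∧ (hessian F p).rank = n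

/-- `S ⊆ ℙ³` is a Kummer surface: a quartic surface whose singular locus consists of exactly
`16` ordinary double points. (Such a quartic form is automatically nonzero and squarefree, so
the surface is determined by its set of points.) -/
def IsKummerSurface (S : Set (ProjSpace 3)) : Prop :=
  ∃ F : MvPolynomial (Fin 4) ℂ, F.IsHomogeneous 4 ∧ S = zeroLocus F ∧
    (singularLocus F).ncard = 16 ∧ ∀ p ∈ singularLocus F, IsOrdinaryDoublePoint F p

/-- Two hypersurfaces in `ℙⁿ` are projectively equivalent if an automorphism of `ℙⁿ`, i.e. the
projective transformation given by a linear automorphism of `ℂⁿ⁺¹`, maps one onto the other. -/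
def ProjectivelyEquivalent {n : ℕ} (S S' : Set (ProjSpace n)) : Prop :=
  ∃ g : (Fin (n + 1) → ℂ) ≃ₗ[ℂ] (Fin (n + 1) → ℂ),
    Projectivization.map g.toLinearMap g.injective '' S = S'

/-! ### Principally polarized complex tori `A = V / Λ` -/

section Torus

variable {V : Type*} [NormedAddCommGroup V] [NormedSpace ℂ V]

/-- A principal polarization `θ ∈ NS(A)` of the complex torus `A = V / Λ`. The Néron-Severi group
`NS(A) ⊆ H²(A, ℤ)` is the group of all alternating forms `E` on `V` which are integral on `Λ` and
satisfy `E(iv, iw) = E(v, w)`. The class is a polarization if the associated Hermitian form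
`H(v, w) = E(iv, w) + i E(v, w)` is positive definite, and a principal one if moreover `E` is
unimodular on `Λ`. -/
structure PrincipalPolarization (Λ : Submodule ℤ V) where
  form : LinearMap.BilinForm ℝ V
  alt : ∀ v, form v v = 0
  map_I : ∀ v w, form (Complex.I • v) (Complex.I • w) = form v w
  integral : ∀ l ∈ Λ, ∀ m ∈ Λ, ∃ k : ℤ, form l m = k
  pos : ∀ v, v ≠ 0 → 0 < form (Complex.I • v) v
  unimodular : ∀ φ : Λ →ₗ[ℤ] ℤ, ∃ m ∈ Λ, ∀ l : Λ, form l m = φ l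

/-- The principally polarized complex tori `(V / Λ, θ)` and `(V' / Λ', θ')` are isomorphic: there
is an isomorphism of complex Lie groups, i.e. a `ℂ`-linear isomorphism `g : V → V'` with
`g(Λ) = Λ'`, such that `g^* θ' = θ`. -/
def PrincipalPolarization.Isomorphic {V' : Type*} [NormedAddCommGroup V'] [NormedSpace ℂ V']
    {Λ : Submodule ℤ V} {Λ' : Submodule ℤ V'}
    (θ : PrincipalPolarization Λ) (θ' : PrincipalPolarization Λ') : Prop :=
  ∃ g : V ≃ₗ[ℂ] V', (∀ v, g v ∈ Λ' ↔ v ∈ Λ) ∧ ∀ v w, θ'.form (g v) (g w) = θ.form v w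

/-- `Φ` is a lift on `U ⊆ V` of the map `π : V / Λ → ℙⁿ` to homogeneous coordinates without
common zeros. -/
def IsLiftOn {n : ℕ} {Λ : Submodule ℤ V} (π : V ⧸ Λ → ProjSpace n) (U : Set V)
    (Φ : V → Fin (n + 1) → ℂ) : Prop :=
  ∀ v ∈ U, ∃ h : Φ v ≠ 0, π (Submodule.Quotient.mk v) = Projectivization.mk ℂ (Φ v) h

/-- The map `π : V / Λ → ℙⁿ` is holomorphic: locally it has holomorphic homogeneous coordinates
without common zeros. -/
def IsHolomorphic {n : ℕ} {Λ : Submodule ℤ V} (π : V ⧸ Λ → ProjSpace n) : Prop :=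
  ∀ v : V, ∃ U ∈ 𝓝 v, ∃ Φ : V → Fin (n + 1) → ℂ, DifferentiableOn ℂ Φ U ∧ IsLiftOn π U Φ

/-- `π : A → S` exhibits `S ⊆ ℙ³` as the quotient of `A = V / Λ` by its standard involution `-id`:
it is a holomorphic map with image `S`, whose fibres are precisely the orbits of `-id`.
(If `S` is a Kummer surface, then `S` is normal, so the holomorphic bijection from `A / -id` to `S`
is automatically an isomorphism.) -/
structure IsKummerCovering {Λ : Submodule ℤ V} (π : V ⧸ Λ → ProjSpace 3)
    (S : Set (ProjSpace 3)) : Prop where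
  holomorphic : IsHolomorphic π
  range_eq : Set.range π = S
  fibre : ∀ x y, π x = π y ↔ x = y ∨ x = -y

/-- The class (first Chern class) of the line bundle `π^* 𝒪(1)` in `NS(A) ⊆ H²(A, ℤ)` is given by
the form `E`, where `A = V / Λ` and `π : A → ℙⁿ` is holomorphic.

A global holomorphic lift `Φ : V → ℂⁿ⁺¹ ∖ {0}` of `π` is the same thing as a trivialization of the
pullback of `π^* 𝒪(1)` to `V`; the corresponding factor of automorphy is the family of nowhere
vanishing holomorphic functions `e_l` on `V` with `Φ(v + l) = e_l(v) Φ(v)` for `l ∈ Λ`.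
Writing `e_l = exp(2πi f_l)` with `f_l` holomorphic, the connecting homomorphism of the exponential
sequence maps this line bundle to the alternating form
`E(l, m) = f_m(v + l) + f_l(v) - f_l(v + m) - f_m(v)` on `Λ`, where `H²(A, ℤ)` is identified with
the group of alternating integral forms on `Λ`. This form does not depend on `v`, `Φ`
and `f`. -/
def PullbackO1HasClass {n : ℕ} {Λ : Submodule ℤ V} (π : V ⧸ Λ → ProjSpace n)
    (E : LinearMap.BilinForm ℝ V) : Prop :=
  ∃ (Φ : V → Fin (n + 1) → ℂ) (f : Λ → V → ℂ),
    Differentiable ℂ Φ ∧ IsLiftOn π Set.univ Φ ∧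
    (∀ l, Differentiable ℂ (f l)) ∧
    (∀ (l : Λ) (v : V),
      Φ (v + l) = Complex.exp (2 * (Real.pi : ℂ) * Complex.I * f l v) • Φ v) ∧
    ∀ (l m : Λ) (v : V),
      f m (v + l) + f l v - f l (v + m) - f m v = ((E (l : V) (m : V) : ℝ) : ℂ)

end Torus

end KummerSurface

/-!
The two Kummer coverings, transported to the same torus `V / Λ` by the given isomorphism, are
described by the same space of theta functions, so their homogeneous coordinates differ by a linear
substitution.

Write `H` for the Hermitian form of `θ` and let `π` be a Kummer covering with class `2θ`. By
`exists_lift_with_exponential_factors` (a weak form of the Appell-Humbert theorem) a global lift of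
`π` can be multiplied by a nowhere vanishing entire function so that its factors of automorphy
become constant multiples of `exp (2π H(v, l))`. Since `π` is invariant under `-id`, the lift can
moreover be made even, and its values at the half periods then force the constants to be
`exp (π H(l, l))` (`exists_lift_mem_thetaSpace`). So the coordinates of the lift lie in the space
`PrincipalPolarization.thetaSpace`, which depends only on `(V / Λ, θ)`.

This space has dimension at most four (`PrincipalPolarization.finrank_thetaSpace_le`): with respect
to a symplectic basis its elements become classical theta functions, and the quasi-periods
relate the Fourier coefficients whose indices agree modulo two. On the other hand the four
coordinates are linearly independent, because a quartic surface which is set-theoretically contained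
in a plane has vanishing Hessian at all of its points (`IsKummerSurface.not_planar`). Hence the
coordinates of both coverings are bases of the same space.

The analytic input is that a cocycle of entire functions on `V` is constant up to the increments of
an entire function (`exists_differentiable_increments`). It is obtained without harmonic analysis on
the torus. Some continuous function has the given increments. Averaging it with a smooth weight
invariant under rotations preserves the increments, by the mean value property, and contracts
the oscillation of periodic functions; so iterated averaging converges, up to constants, to a `C¹`
function with the same increments. Its antiholomorphic derivatives are periodic and invariant under
averaging, hence constant, and subtracting an antilinear form makes it holomorphic.
-/

namespace KummerSurface

/-! ### Averages with rotation invariant weights -/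

section Averaging

open MeasureTheory

variable {V : Type*} [NormedAddCommGroup V] [NormedSpace ℂ V]
  [MeasurableSpace V] [BorelSpace V] {μ : Measure V}

/-- A nonnegative, compactly supported weight `K` of class `C¹` and total mass one on a complex vector
space which is invariant under multiplication by complex numbers of absolute value one. -/
structure IsRotationKernel {V : Type*} [NormedAddCommGroup V] [NormedSpace ℂ V]
    [MeasurableSpace V] (μ : Measure V) (K : V → ℝ) : Prop where
  contDiff : ContDiff ℝ 1 K
  hasCompactSupport : HasCompactSupport K
  nonneg : ∀ w, 0 ≤ K w
  map_smul : ∀ (c : ℂ) (w : V), ‖c‖ = 1 → K (c • w) = K w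
  integral_eq_one : ∫ w, K w ∂μ = 1

/-- The average of `g` around `v` with weight `K`. -/
noncomputable def average {V : Type*} [AddCommGroup V] [MeasurableSpace V] (μ : Measure V)
    (K : V → ℝ) (g : V → ℂ) (v : V) : ℂ :=
  ∫ w, K w • g (v + w) ∂μ

/-- Multiplication by a complex number of absolute value one preserves Haar measure, because it
preserves the unit ball. -/
theorem measurePreserving_unit_smul [FiniteDimensional ℂ V] [μ.IsAddHaarMeasure] (c : ℂ)
    (hc : ‖c‖ = 1) :
    MeasurePreserving (fun w : V ↦ c • w) μ μ := by
  have : FiniteDimensional ℝ V := FiniteDimensional.complexToReal V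
  have hc0 : c ≠ 0 := by rintro rfl; simp at hc
  have hcont : Continuous fun w : V ↦ c • w := continuous_const_smul c
  refine ⟨hcont.measurable, ?_⟩
  let f : V ≃ₗ[ℝ] V := (LinearEquiv.smulOfNeZero ℂ V c hc0).restrictScalars ℝ
  have hf : LinearMap.det (f : V →ₗ[ℝ] V) ≠ 0 := f.isUnit_det'.ne_zero
  have hpre := Measure.addHaar_preimage_linearMap μ hf
  have hball : (f : V →ₗ[ℝ] V) ⁻¹' Metric.ball 0 1 = Metric.ball 0 1 := by
    ext w
    simp [f, norm_smul, hc]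
  have h1 := hpre (Metric.ball 0 1)
  rw [hball] at h1
  have hpos : μ (Metric.ball (0 : V) 1) ≠ 0 := (Metric.measure_ball_pos μ 0 one_pos).ne'
  have hfin : μ (Metric.ball (0 : V) 1) ≠ ⊤ := measure_ball_lt_top.ne
  have h2 : ENNReal.ofReal |(LinearMap.det (f : V →ₗ[ℝ] V))⁻¹| = 1 := by
    have h3 : ENNReal.ofReal |(LinearMap.det (f : V →ₗ[ℝ] V))⁻¹| * μ (Metric.ball (0 : V) 1)
        = 1 * μ (Metric.ball (0 : V) 1) := by rw [one_mul]; exact h1.symm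
    exact (ENNReal.mul_left_inj hpos hfin).1 h3
  ext s hs
  rw [Measure.map_apply hcont.measurable hs]
  have := hpre s
  rw [h2, one_mul] at this
  exact this

/-- A rotation kernel which is bounded away from zero on a given bounded set, obtained by
normalizing a smooth cutoff function of a Hermitian norm. -/
theorem exists_isRotationKernel [FiniteDimensional ℂ V] (μ : Measure V) [μ.IsAddHaarMeasure]
    {s : Set V} (hs : Bornology.IsBounded s) :
    ∃ K : V → ℝ, IsRotationKernel μ K ∧ ∃ δ > 0, ∀ w ∈ s, δ ≤ K w := by
  have : FiniteDimensional ℝ V := FiniteDimensional.complexToReal V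
  let e : V ≃L[ℂ] EuclideanSpace ℂ (Fin (Module.finrank ℂ V)) :=
    ContinuousLinearEquiv.ofFinrankEq (by simp)
  obtain ⟨R, hR⟩ : ∃ R : ℝ, ∀ w ∈ s, ‖e w‖ ≤ R := by
    have : Bornology.IsBounded (e '' s) := e.lipschitz.isBounded_image hs
    obtain ⟨R, hR⟩ := this.exists_norm_le
    exact ⟨R, fun w hw ↦ hR _ ⟨w, hw, rfl⟩⟩
  -- `k` is `1` where `‖e w‖ ≤ R` and vanishes far away.
  let k : V → ℝ := fun w ↦ Real.smoothTransition (R ^ 2 + 2 - ‖e w‖ ^ 2)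
  have hk1 : ContDiff ℝ 1 k := by
    have h1 : ContDiff ℝ 1 (fun w : V ↦ e w) :=
      (ContinuousLinearEquiv.contDiff (𝕜 := ℂ) e).restrict_scalars ℝ
    exact Real.smoothTransition.contDiff.comp (contDiff_const.sub (h1.norm_sq ℝ))
  have hk2 : HasCompactSupport k := by
    refine HasCompactSupport.intro
      (K := e.symm '' Metric.closedBall 0 (R ^ 2 + 2)) ?_ fun w hw ↦ ?_
    · exact (isCompact_closedBall _ _).image e.symm.continuous
    · apply Real.smoothTransition.zero_of_nonpos
      have : ¬ ‖e w‖ ≤ R ^ 2 + 2 := fun h ↦ hw ⟨e w, by simpa using h, by simp⟩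
      nlinarith [sq_nonneg R]
  have hk3 : ∀ w, 0 ≤ k w := fun w ↦ Real.smoothTransition.nonneg _
  have hk4 : ∀ w ∈ s, k w = 1 := fun w hw ↦ by
    apply Real.smoothTransition.one_of_one_le
    nlinarith [hR w hw, norm_nonneg (e w)]
  have hk5 : ∀ (c : ℂ) (w : V), ‖c‖ = 1 → k (c • w) = k w := fun c w hc ↦ by
    simp [k, norm_smul, hc]
  have hk6 : 0 < ∫ w, k w ∂μ := by
    refine hk1.continuous.integral_pos_of_hasCompactSupport_nonneg_nonzero hk2 hk3 (x := 0) ?_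
    have : 0 < k 0 := Real.smoothTransition.pos_of_pos (by simp; positivity)
    exact this.ne'
  refine ⟨fun w ↦ (∫ w, k w ∂μ)⁻¹ * k w, ⟨contDiff_const.mul hk1, hk2.mul_left, fun w ↦
    mul_nonneg (inv_nonneg.2 hk6.le) (hk3 w), fun c w hc ↦ by rw [hk5 c w hc], ?_⟩,
    (∫ w, k w ∂μ)⁻¹, inv_pos.2 hk6, fun w hw ↦ by simp [hk4 w hw]⟩
  rw [integral_const_mul, inv_mul_cancel₀ hk6.ne']

variable {K : V → ℝ}

theorem IsRotationKernel.integrable [IsFiniteMeasureOnCompacts μ] (hK : IsRotationKernel μ K)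
    {g : V → ℂ} (hg : Continuous g) :
    Integrable (fun w ↦ K w • g w) μ :=
  (hK.contDiff.continuous.smul hg).integrable_of_hasCompactSupport
    hK.hasCompactSupport.smul_right

theorem IsRotationKernel.average_const {V : Type*} [NormedAddCommGroup V] [NormedSpace ℂ V]
    [MeasurableSpace V] {μ : Measure V} {K : V → ℝ} (hK : IsRotationKernel μ K) (c : ℂ) (v : V) :
    average μ K (fun _ ↦ c) v = c := by
  simp only [average]
  rw [integral_smul_const, hK.integral_eq_one, one_smul]

theorem IsRotationKernel.average_add [IsFiniteMeasureOnCompacts μ] (hK : IsRotationKernel μ K)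
    {g h : V → ℂ} (hg : Continuous g) (hh : Continuous h) (v : V) :
    average μ K (fun x ↦ g x + h x) v = average μ K g v + average μ K h v := by
  simp only [average, smul_add]
  exact integral_add (hK.integrable (hg.comp (continuous_const_add v)))
    (hK.integrable (hh.comp (continuous_const_add v)))

theorem IsRotationKernel.average_sub [IsFiniteMeasureOnCompacts μ] (hK : IsRotationKernel μ K)
    {g h : V → ℂ} (hg : Continuous g) (hh : Continuous h) (v : V) :
    average μ K (fun x ↦ g x - h x) v = average μ K g v - average μ K h v := by
  simp only [average, smul_sub]
  exact integral_sub (hK.integrable (hg.comp (continuous_const_add v)))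
    (hK.integrable (hh.comp (continuous_const_add v)))

theorem average_translate {V : Type*} [AddCommGroup V] [MeasurableSpace V] (μ : Measure V)
    (K : V → ℝ) (g : V → ℂ) (v x : V) :
    average μ K (fun y ↦ g (y + x)) v = average μ K g (v + x) := by
  simp only [average, add_right_comm]

/-- Averages of continuous functions are continuously differentiable. -/
theorem IsRotationKernel.contDiff_average [FiniteDimensional ℂ V] [μ.IsAddHaarMeasure]
    (hK : IsRotationKernel μ K) {g : V → ℂ} (hg : Continuous g) : ContDiff ℝ 1 (average μ K g) := by
  have : FiniteDimensional ℝ V := FiniteDimensional.complexToReal V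
  have h := hK.hasCompactSupport.contDiff_convolution_left (n := 1) (μ := μ)
    (ContinuousLinearMap.lsmul ℝ ℝ) hK.contDiff (hg.locallyIntegrable (μ := μ))
  suffices heq : average μ K g = convolution K g (ContinuousLinearMap.lsmul ℝ ℝ) μ by
    rw [heq]; exact h
  funext v
  simp only [average, convolution_def, ContinuousLinearMap.lsmul_apply]
  rw [← integral_neg_eq_self]
  refine integral_congr_ae (Filter.Eventually.of_forall fun w ↦ ?_)
  have : K (-w) = K w := by simpa using hK.map_smul (-1) w (by simp)
  simp [this, sub_eq_add_neg]

/-- The mean value property: rotation kernels reproduce holomorphic functions. -/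
theorem IsRotationKernel.average_eq_self [FiniteDimensional ℂ V] [μ.IsAddHaarMeasure]
    (hK : IsRotationKernel μ K) {a : V → ℂ} (ha : Differentiable ℂ a) (v : V) :
    average μ K a v = a v := by
  have : FiniteDimensional ℝ V := FiniteDimensional.complexToReal V
  have hrot : ∀ t : ℝ, ∫ w, K w • a (v + circleMap 0 1 t • w) ∂μ = average μ K a v := by
    intro t
    have hc : ‖circleMap 0 1 t‖ = 1 := by simp
    have hc0 : circleMap 0 1 t ≠ 0 := by intro h; simp [h] at hc
    have hme : MeasurableEmbedding (fun w : V ↦ circleMap 0 1 t • w) :=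
      (Homeomorph.smulOfNeZero _ hc0).measurableEmbedding
    rw [average, ← (measurePreserving_unit_smul (μ := μ) _ hc).integral_comp hme
      (fun w ↦ K w • a (v + w))]
    simp_rw [hK.map_smul _ _ hc]
  have hmean : ∀ w : V, ∫ t in (0 : ℝ)..2 * Real.pi, K w • a (v + circleMap 0 1 t • w)
      = (2 * Real.pi) • K w • a v := by
    intro w
    have hd : Differentiable ℂ fun ζ : ℂ ↦ a (v + ζ • w) := by fun_prop
    have h := DiffContOnCl.circleAverage (R := 1) (c := 0) hd.diffContOnCl
    rw [Real.circleAverage] at h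
    rw [intervalIntegral.integral_smul, smul_comm]
    congr 1
    simp only [zero_smul, add_zero] at h
    rw [← h, smul_inv_smul₀ (by positivity)]
  have hint : Integrable (Function.uncurry fun (t : ℝ) (w : V) ↦
      K w • a (v + circleMap 0 1 t • w))
      ((volume.restrict (Set.Ioc 0 (2 * Real.pi))).prod μ) := by
    have hcont : Continuous (Function.uncurry fun (t : ℝ) (w : V) ↦
        K w • a (v + circleMap 0 1 t • w)) := by
      have := hK.contDiff.continuous
      have := ha.continuous
      simp only [Function.uncurry_def]
      fun_prop
    have h1 : IntegrableOn (Function.uncurry fun (t : ℝ) (w : V) ↦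
        K w • a (v + circleMap 0 1 t • w))
        (Set.Icc 0 (2 * Real.pi) ×ˢ tsupport K) (volume.prod μ) :=
      hcont.continuousOn.integrableOn_compact (isCompact_Icc.prod hK.hasCompactSupport)
    have h2 : (volume.restrict (Set.Ioc 0 (2 * Real.pi))).prod μ
        = (volume.prod μ).restrict (Set.Ioc 0 (2 * Real.pi) ×ˢ Set.univ) := by
      rw [← Measure.prod_restrict, Measure.restrict_univ]
    rw [h2]
    refine IntegrableOn.of_forall_sdiff_eq_zero (s := Set.Ioc 0 (2 * Real.pi) ×ˢ tsupport K)
      (h1.mono_set (Set.prod_mono Set.Ioc_subset_Icc_self le_rfl))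
      (measurableSet_Ioc.prod MeasurableSet.univ) ?_
    rintro ⟨t, w⟩ ⟨⟨ht, -⟩, hw⟩
    have : w ∉ tsupport K := fun h ↦ hw ⟨ht, h⟩
    simp [image_eq_zero_of_notMem_tsupport this]
  have hswap := integral_integral_swap hint
  simp only [hrot] at hswap
  simp only [← intervalIntegral.integral_of_le Real.two_pi_pos.le, hmean] at hswap
  rw [intervalIntegral.integral_const, integral_smul, integral_smul_const, hK.integral_eq_one,
    one_smul, sub_zero] at hswap
  exact smul_right_injective ℂ (Real.two_pi_pos.ne') hswap

end Averaging

/-! ### Averages of periodic functions -/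

section Contraction

open MeasureTheory
open scoped Pointwise

variable {V : Type*} [NormedAddCommGroup V] [NormedSpace ℂ V]
  [MeasurableSpace V] [BorelSpace V] {μ : Measure V} {K : V → ℝ}

/-- The integral of a periodic function over a translate of a fundamental domain does not depend
on the translate. -/
theorem setIntegral_fundamentalDomain_translate [FiniteDimensional ℝ V] [μ.IsAddHaarMeasure]
    (Λ : Submodule ℤ V)
    [DiscreteTopology Λ] [IsZLattice ℝ Λ] {F : Set V} (hF : IsAddFundamentalDomain Λ F μ)
    {p : V → ℂ} (hp : ∀ l ∈ Λ, ∀ v, p (v + l) = p v) (v : V) :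
    ∫ w in F, p (v + w) ∂μ = ∫ w in F, p w ∂μ := by
  have : VAddInvariantMeasure Λ V μ := ⟨fun l s _ ↦ measure_preimage_add μ (l : V) s⟩
  have : MeasurableConstVAdd Λ V := ⟨fun l ↦ measurable_const_add (l : V)⟩
  have : Countable Λ := inferInstance
  have : VAddCommClass V Λ V := ⟨fun x l y ↦ add_left_comm x (l : V) y⟩
  have hF' : IsAddFundamentalDomain Λ (v +ᵥ F) μ := hF.vadd_of_comm v
  rw [hF.setIntegral_eq hF' (f := p) fun l x ↦ by
    rw [Submodule.vadd_def, vadd_eq_add, add_comm]; exact hp l l.2 x]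
  have h := (measurePreserving_add_left μ v).setIntegral_image_emb
    (measurableEmbedding_addLeft v) p F
  rw [← h]
  rfl

/-- Averaging contracts the oscillation of periodic functions by a fixed factor: the kernel
dominates a multiple of the indicator function of a fundamental domain, and that part of the
kernel does not contribute to differences of averages. -/
theorem exists_contracting_rotationKernel [FiniteDimensional ℂ V] (μ : Measure V)
    [μ.IsAddHaarMeasure] (Λ : Submodule ℤ V) [DiscreteTopology Λ] [IsZLattice ℝ Λ] :
    ∃ K : V → ℝ, IsRotationKernel μ K ∧ ∃ r : ℝ, 0 ≤ r ∧ r < 1 ∧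
      ∀ p : V → ℂ, Continuous p → (∀ l ∈ Λ, ∀ v, p (v + l) = p v) →
        ∀ C : ℝ, (∀ v v', ‖p v - p v'‖ ≤ C) →
          ∀ v v', ‖average μ K p v - average μ K p v'‖ ≤ r * C := by
  have : FiniteDimensional ℝ V := FiniteDimensional.complexToReal V
  have : Module.Free ℤ Λ := ZLattice.module_free ℝ Λ
  have : Module.Finite ℤ Λ := ZLattice.module_finite ℝ Λ
  let b := (Module.Free.chooseBasis ℤ Λ).ofZLatticeBasis ℝ Λ
  let F : Set V := ZSpan.fundamentalDomain b
  have hF : IsAddFundamentalDomain Λ F μ :=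
    ZLattice.isAddFundamentalDomain (Module.Free.chooseBasis ℤ Λ) μ
  have hFb : Bornology.IsBounded F := ZSpan.fundamentalDomain_isBounded b
  have hFm : MeasurableSet F := ZSpan.fundamentalDomain_measurableSet b
  have hF0 : μ F ≠ 0 := ZSpan.measure_fundamentalDomain_ne_zero b
  have hFtop : μ F ≠ ⊤ := hFb.measure_lt_top.ne
  obtain ⟨K, hK, δ, hδ, hKδ⟩ := exists_isRotationKernel μ hFb
  let k : V → ℝ := fun w ↦ K w - F.indicator (fun _ ↦ δ) w
  have hk0 : ∀ w, 0 ≤ k w := by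
    intro w
    by_cases hw : w ∈ F
    · simpa [k, hw] using hKδ w hw
    · simpa [k, hw] using hK.nonneg w
  have hKint : Integrable K μ :=
    hK.contDiff.continuous.integrable_of_hasCompactSupport hK.hasCompactSupport
  have hFint : Integrable (F.indicator fun _ ↦ δ) μ :=
    (integrable_indicator_iff hFm).2 (integrableOn_const hFtop)
  have hkint : Integrable k μ := hKint.sub hFint
  have hkval : ∫ w, k w ∂μ = 1 - μ.real F * δ := by
    rw [integral_sub hKint hFint, hK.integral_eq_one, integral_indicator hFm,
      setIntegral_const, smul_eq_mul]
  refine ⟨K, hK, 1 - μ.real F * δ, hkval ▸ integral_nonneg hk0, ?_, ?_⟩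
  · have : 0 < μ.real F := ENNReal.toReal_pos hF0 hFtop
    nlinarith
  intro p hp hper C hC v v'
  have hsplit : ∀ v, average μ K p v
      = ∫ w, k w • p (v + w) ∂μ + δ • ∫ w in F, p w ∂μ := by
    intro v
    have hcont : Continuous fun w ↦ p (v + w) := hp.comp (continuous_const_add v)
    have h1 : Integrable (fun w ↦ F.indicator (fun _ ↦ δ) w • p (v + w)) μ := by
      have : (fun w ↦ F.indicator (fun _ ↦ δ) w • p (v + w))
          = F.indicator fun w ↦ δ • p (v + w) := by
        funext w
        by_cases hw : w ∈ F <;> simp [hw]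
      rw [this, integrable_indicator_iff hFm]
      exact ((hcont.const_smul δ).continuousOn.integrableOn_compact hFb.isCompact_closure).mono_set
        subset_closure
    have h2 : ∫ w, F.indicator (fun _ ↦ δ) w • p (v + w) ∂μ = δ • ∫ w in F, p w ∂μ := by
      rw [← setIntegral_fundamentalDomain_translate Λ hF hper v, ← integral_smul,
        ← integral_indicator hFm]
      congr 1
      funext w
      by_cases hw : w ∈ F <;> simp [hw]
    rw [← h2, ← integral_add]
    · simp only [average, k, sub_smul, sub_add_cancel]
    · simp only [k, sub_smul]
      exact (hK.integrable hcont).sub h1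
    · exact h1
  have hbdd : ∃ M, ∀ v, ‖p v‖ ≤ M := by
    refine ⟨C + ‖p 0‖, fun v ↦ ?_⟩
    linarith [norm_le_norm_add_norm_sub' (p v) (p 0), hC v 0]
  obtain ⟨M, hM⟩ := hbdd
  have hkp : ∀ v, Integrable (fun w ↦ k w • p (v + w)) μ := fun v ↦ by
    exact hkint.smul_bdd M (hp.comp (continuous_const_add v)).aestronglyMeasurable
      (Filter.Eventually.of_forall fun w ↦ hM _)
  rw [hsplit, hsplit, add_sub_add_right_eq_sub, ← integral_sub (hkp v) (hkp v'), ← hkval,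
    ← integral_mul_const]
  refine norm_integral_le_of_norm_le (hkint.mul_const C) (Filter.Eventually.of_forall fun w ↦ ?_)
  rw [← smul_sub, norm_smul, Real.norm_of_nonneg (hk0 w)]
  exact mul_le_mul_of_nonneg_left (hC _ _) (hk0 w)

end Contraction

/-! ### Functions with prescribed increments -/

section Increments

variable {V : Type*} [NormedAddCommGroup V] [NormedSpace ℂ V] [FiniteDimensional ℂ V]

theorem exists_oscillation_bound (Λ : Submodule ℤ V) [DiscreteTopology Λ] [IsZLattice ℝ Λ]
    {p : V → ℂ} (hp : Continuous p) (hper : ∀ l ∈ Λ, ∀ v, p (v + l) = p v) :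
    ∃ C, ∀ v v', ‖p v - p v'‖ ≤ C := by
  have : FiniteDimensional ℝ V := FiniteDimensional.complexToReal V
  have h := (IsZLattice.isCompact_range_of_periodic Λ p hp fun z w hw ↦ hper w hw z).isBounded
  obtain ⟨C, hC⟩ := Metric.isBounded_iff.1 h
  exact ⟨C, fun v v' ↦ by rw [← dist_eq_norm]; exact hC ⟨v, rfl⟩ ⟨v', rfl⟩⟩

/-- Liouville's theorem for functions on a complex torus. -/
theorem eq_of_differentiable_of_periodic (Λ : Submodule ℤ V) [DiscreteTopology Λ] [IsZLattice ℝ Λ]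
    {p : V → ℂ} (hp : Differentiable ℂ p) (hper : ∀ l ∈ Λ, ∀ v, p (v + l) = p v) (v w : V) :
    p v = p w := by
  have : FiniteDimensional ℝ V := FiniteDimensional.complexToReal V
  exact hp.apply_eq_apply_of_bounded (IsZLattice.isCompact_range_of_periodic Λ p hp.continuous
    fun z w hw ↦ hper w hw z).isBounded v w

/-- A cocycle of continuous functions is the family of increments of a continuous function: if
`ρ` is a bump function whose translates cover `V`, a solution is the average of the functions
`v ↦ a l (v - l)` with weights `ρ (v - l)`. -/
theorem exists_continuous_increments (Λ : Submodule ℤ V) [DiscreteTopology Λ] [IsZLattice ℝ Λ]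
    (a : Λ → V → ℂ) (ha : ∀ l, Continuous (a l))
    (hadd : ∀ l m v, a (l + m) v = a l (v + m) + a m v) :
    ∃ g : V → ℂ, Continuous g ∧ ∀ (l : Λ) v, g (v + l) = g v + a l v := by
  have : FiniteDimensional ℝ V := FiniteDimensional.complexToReal V
  have : Module.Free ℤ Λ := ZLattice.module_free ℝ Λ
  have : Module.Finite ℤ Λ := ZLattice.module_finite ℝ Λ
  let b := (Module.Free.chooseBasis ℤ Λ).ofZLatticeBasis ℝ Λ
  have hspan : Submodule.span ℤ (Set.range b) = Λ :=
    (Module.Free.chooseBasis ℤ Λ).ofZLatticeBasis_span ℝ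
  obtain ⟨R, hR⟩ := (ZSpan.fundamentalDomain_isBounded b).exists_norm_le
  let ρ : V → ℝ := fun v ↦ max 0 (R + 1 - ‖v‖)
  have hρc : Continuous ρ := by fun_prop
  have hρ0 : ∀ v, 0 ≤ ρ v := fun v ↦ le_max_left _ _
  have hρsupp : ∀ v, ρ v ≠ 0 → ‖v‖ ≤ R + 1 := fun v hv ↦ by
    by_contra! h
    exact hv (max_eq_left (by linarith))
  have hρpos : ∀ v, ∃ l : Λ, 0 < ρ (v - l) := fun v ↦ by
    refine ⟨⟨ZSpan.floor b v, hspan.le (ZSpan.floor b v).2⟩, ?_⟩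
    have := hR _ (ZSpan.fract_mem_fundamentalDomain b v)
    rw [ZSpan.fract_apply] at this
    exact lt_max_of_lt_right (by simp only; linarith)
  have hfin : ∀ B : ℝ, {l : Λ | ‖(l : V)‖ ≤ B}.Finite := by
    intro B
    have h1 : ((Metric.closedBall (0 : V) B) ∩ (Λ : Set V)).Finite := by
      rw [← hspan]
      exact ZSpan.setFinite_inter b Metric.isBounded_closedBall
    refine (h1.preimage Subtype.val_injective.injOn).subset fun l hl ↦ ⟨by simpa using hl, l.2⟩
  have hloc : LocallyFinite fun l : Λ ↦ Function.support fun v ↦ ρ (v - l) := by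
    intro v
    refine ⟨Metric.ball v 1, Metric.ball_mem_nhds v one_pos,
      (hfin (R + 1 + ‖v‖ + 1)).subset ?_⟩
    rintro l ⟨w, hw1, hw2⟩
    have h1 := hρsupp _ hw1
    have h2 : ‖w - v‖ < 1 := by simpa [dist_eq_norm] using hw2
    have h3 : (l : V) = v + (w - v) - (w - l) := by abel
    calc ‖(l : V)‖ = ‖v + (w - v) - (w - l)‖ := by rw [← h3]
      _ ≤ ‖v + (w - v)‖ + ‖w - l‖ := norm_sub_le _ _
      _ ≤ ‖v‖ + ‖w - v‖ + ‖w - l‖ := by gcongr; exact norm_add_le _ _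
      _ ≤ R + 1 + ‖v‖ + 1 := by linarith
  let P : V → ℝ := fun v ↦ ∑ᶠ l : Λ, ρ (v - l)
  let N : V → ℂ := fun v ↦ ∑ᶠ l : Λ, ρ (v - l) • a l (v - l)
  have hsuppfin : ∀ v, (fun l : Λ ↦ ρ (v - l)).HasFiniteSupport := fun v ↦
    hloc.point_finite v
  have hPc : Continuous P :=
    continuous_finsum (fun l ↦ hρc.comp (continuous_sub_right _)) hloc
  have hNc : Continuous N := by
    refine continuous_finsum (fun l ↦ (hρc.comp (continuous_sub_right _)).smul
      ((ha l).comp (continuous_sub_right _))) (hloc.subset fun l v hv ↦ ?_)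
    exact fun h ↦ hv (by simp [h])
  have hP0 : ∀ v, P v ≠ 0 := fun v ↦ by
    obtain ⟨l, hl⟩ := hρpos v
    exact (finsum_pos (f := fun l : Λ ↦ ρ (v - l)) (fun l ↦ hρ0 _) ⟨l, hl⟩ (hsuppfin v)).ne'
  have hPper : ∀ (m : Λ) v, P (v + m) = P v := fun m v ↦ by
    simp only [P]
    rw [← finsum_comp_equiv (Equiv.addRight m)]
    refine finsum_congr fun l ↦ ?_
    simp
  have hNinc : ∀ (m : Λ) v, N (v + m) = N v + P v • a m v := fun m v ↦ by
    simp only [N, P]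
    rw [← finsum_comp_equiv (Equiv.addRight m), finsum_smul,
      ← finsum_add_distrib]
    · refine finsum_congr fun l ↦ ?_
      have h1 : v + (m : V) - ((l + m : Λ) : V) = v - l := by push_cast; abel
      have h2 : a (m + l) (v - l) = a m v + a l (v - l) := by rw [hadd, sub_add_cancel]
      rw [Equiv.coe_addRight, h1]
      change ρ (v - l) • a (l + m) (v - l) = _
      rw [add_comm l m, h2, smul_add, add_comm]
    · exact (hsuppfin v).subset fun l hl h ↦ hl (by simp [h])
    · exact (hsuppfin v).subset fun l hl h ↦ hl (by simp [h])
  refine ⟨fun v ↦ (P v)⁻¹ • N v, (hPc.inv₀ hP0).smul hNc, fun m v ↦ ?_⟩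
  simp only
  rw [hPper, hNinc, smul_add, inv_smul_smul₀ (hP0 v)]

end Increments

/-! ### Cocycles of entire functions -/

section Cohomology

open MeasureTheory

variable {V : Type*} [NormedAddCommGroup V] [NormedSpace ℂ V] [FiniteDimensional ℂ V]

/-- Averaging with a rotation kernel commutes with directional derivatives. -/
theorem IsRotationKernel.fderiv_average [MeasurableSpace V] [BorelSpace V] {μ : Measure V}
    [μ.IsAddHaarMeasure] {K : V → ℝ} (hK : IsRotationKernel μ K) {g : V → ℂ}
    (hg : ContDiff ℝ 1 g) (v x : V) :
    fderiv ℝ (average μ K g) v x = average μ K (fun y ↦ fderiv ℝ g y x) v := by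
  have : FiniteDimensional ℝ V := FiniteDimensional.complexToReal V
  have hg' : Continuous fun y ↦ fderiv ℝ g y x :=
    (hg.continuous_fderiv one_ne_zero).clm_apply continuous_const
  have hline : ∀ w : V, ∀ t : ℝ, HasDerivAt (fun t : ℝ ↦ K w • g (v + t • x + w))
      (K w • fderiv ℝ g (v + t • x + w) x) t := by
    intro w t
    have h1 : HasDerivAt (fun t : ℝ ↦ v + t • x + w) x t := by
      simpa using (((hasDerivAt_id t).smul_const x).const_add v).add_const w
    exact ((hg.differentiable one_ne_zero _).hasFDerivAt.comp_hasDerivAt t h1).const_smul (K w)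
  obtain ⟨C, hC⟩ : ∃ C, ∀ t ∈ Set.Icc (-1 : ℝ) 1, ∀ w ∈ tsupport K,
      ‖fderiv ℝ g (v + t • x + w) x‖ ≤ C := by
    have hcpt : IsCompact (Set.Icc (-1 : ℝ) 1 ×ˢ tsupport K) :=
      isCompact_Icc.prod hK.hasCompactSupport
    have hcont : Continuous fun y : ℝ × V ↦ fderiv ℝ g (v + y.1 • x + y.2) x :=
      hg'.comp (by fun_prop)
    obtain ⟨C, hC⟩ := hcpt.exists_bound_of_continuousOn hcont.continuousOn
    exact ⟨C, fun t ht w hw ↦ hC (t, w) ⟨ht, hw⟩⟩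
  have hd := (hasDerivAt_integral_of_dominated_loc_of_deriv_le (μ := μ) (𝕜 := ℝ)
    (F := fun t w ↦ K w • g (v + t • x + w))
    (F' := fun t w ↦ K w • fderiv ℝ g (v + t • x + w) x)
    (x₀ := 0) (s := Set.Icc (-1 : ℝ) 1) (bound := fun w ↦ K w * C)
    (Icc_mem_nhds (by norm_num) (by norm_num))
    (Filter.Eventually.of_forall fun t ↦
      (hK.integrable (hg.continuous.comp (continuous_const_add _))).aestronglyMeasurable)
    (hK.integrable (hg.continuous.comp (continuous_const_add _)))
    (hK.integrable (hg'.comp (continuous_const_add _))).aestronglyMeasurable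
    (Filter.Eventually.of_forall fun w t ht ↦ ?_)
    ((hK.contDiff.continuous.integrable_of_hasCompactSupport hK.hasCompactSupport).mul_const C)
    (Filter.Eventually.of_forall fun w t _ ↦ hline w t)).2
  · have h1 : HasDerivAt (fun t : ℝ ↦ v + t • x) x 0 := by
      simpa using ((hasDerivAt_id (0 : ℝ)).smul_const x).const_add v
    have hA := (hK.contDiff_average hg.continuous).differentiable one_ne_zero
    have h2 := HasFDerivAt.comp_hasDerivAt (0 : ℝ)
      (by simpa using (hA v).hasFDerivAt : HasFDerivAt (average μ K g)
        (fderiv ℝ (average μ K g) v) (v + (0 : ℝ) • x)) h1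
    have h3 := h2.unique hd
    simpa [average] using h3
  · by_cases hw : w ∈ tsupport K
    · rw [norm_smul, Real.norm_of_nonneg (hK.nonneg w)]
      exact mul_le_mul_of_nonneg_left (hC t ht w hw) (hK.nonneg w)
    · simp [image_eq_zero_of_notMem_tsupport hw]

/-- Iterated averaging of a continuous function with holomorphic increments converges, up to
additive constants, to a function with the same increments which averaging changes only by a
constant. -/
theorem exists_average_eq_add_const [MeasurableSpace V] [BorelSpace V] {μ : Measure V}
    [μ.IsAddHaarMeasure] (Λ : Submodule ℤ V) [DiscreteTopology Λ] [IsZLattice ℝ Λ]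
    {K : V → ℝ} (hK : IsRotationKernel μ K) {r : ℝ} (hr0 : 0 ≤ r) (hr1 : r < 1)
    (hr : ∀ p : V → ℂ, Continuous p → (∀ l ∈ Λ, ∀ v, p (v + l) = p v) →
      ∀ C : ℝ, (∀ v v', ‖p v - p v'‖ ≤ C) →
        ∀ v v', ‖average μ K p v - average μ K p v'‖ ≤ r * C)
    (a : Λ → V → ℂ) (ha : ∀ l, Differentiable ℂ (a l)) {g₀ : V → ℂ} (hg₀ : Continuous g₀)
    (hinc : ∀ (l : Λ) v, g₀ (v + l) = g₀ v + a l v) :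
    ∃ (g : V → ℂ) (c : ℂ), Continuous g ∧ (∀ (l : Λ) v, g (v + l) = g v + a l v) ∧
      ∀ v, average μ K g v = g v + c := by
  let T : (V → ℂ) → V → ℂ := average μ K
  let G : ℕ → V → ℂ := fun n ↦ T^[n] g₀
  have hGs : ∀ n, G (n + 1) = T (G n) := fun n ↦ Function.iterate_succ_apply' T n g₀
  have hGc : ∀ n, Continuous (G n) := by
    intro n
    induction n with
    | zero => exact hg₀
    | succ n ih => rw [hGs]; exact (hK.contDiff_average ih).continuous
  have hGi : ∀ n (l : Λ) v, G n (v + l) = G n v + a l v := by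
    intro n l
    induction n with
    | zero => exact hinc l
    | succ n ih =>
      intro v
      rw [hGs]
      simp only [T]
      rw [← average_translate]
      simp_rw [ih]
      rw [hK.average_add (hGc n) (ha l).continuous, hK.average_eq_self (ha l)]
  -- The differences of successive iterates are periodic, so their oscillation decays geometrically;
  -- normalized to vanish at `0`, they form a uniformly convergent series.
  let d : ℕ → V → ℂ := fun n v ↦ G (n + 1) v - G n v
  have hdc : ∀ n, Continuous (d n) := fun n ↦ (hGc _).sub (hGc _)
  have hdp : ∀ n, ∀ l ∈ Λ, ∀ v, d n (v + l) = d n v := fun n l hl v ↦ by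
    have h1 := hGi (n + 1) ⟨l, hl⟩ v
    have h2 := hGi n ⟨l, hl⟩ v
    simp only [d]
    rw [h1, h2, add_sub_add_right_eq_sub]
  have hds : ∀ n v, d (n + 1) v = T (d n) v := fun n v ↦ by
    simp only [d, T]
    rw [hK.average_sub (hGc _) (hGc _), hGs (n + 1), hGs n]
  obtain ⟨C, hC⟩ := exists_oscillation_bound Λ (hdc 0) (hdp 0)
  have hosc : ∀ n v v', ‖d n v - d n v'‖ ≤ r ^ n * C := by
    intro n
    induction n with
    | zero => simpa using hC
    | succ n ih =>
      intro v v'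
      rw [hds, hds, pow_succ', mul_assoc]
      exact hr (d n) (hdc n) (hdp n) _ ih v v'
  let s : ℕ → V → ℂ := fun n v ↦ d n v - d n 0
  have hsc : ∀ n, Continuous (s n) := fun n ↦ (hdc n).sub continuous_const
  have hsb : ∀ n v, ‖s n v‖ ≤ r ^ n * C := fun n v ↦ hosc n v 0
  have hgeo : Summable fun n ↦ r ^ n * C := (summable_geometric_of_lt_one hr0 hr1).mul_right C
  have hss : ∀ v, Summable fun n ↦ s n v := fun v ↦ hgeo.of_norm_bounded fun n ↦ hsb n v
  have hSc : Continuous fun v ↦ ∑' n, s n v := continuous_tsum hsc hgeo hsb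
  have hTs : ∀ v, HasSum (fun n ↦ T (s n) v) (T (fun v ↦ ∑' n, s n v) v) := by
    intro v
    have hint : ∀ n, Integrable (fun w ↦ K w • s n (v + w)) μ := fun n ↦
      hK.integrable ((hsc n).comp (continuous_const_add v))
    have h := hasSum_integral_of_summable_integral_norm hint (hgeo.of_nonneg_of_le
      (fun n ↦ integral_nonneg fun w ↦ norm_nonneg _) fun n ↦ ?_)
    · have heq : T (fun v ↦ ∑' n, s n v) v = ∫ w, ∑' n, K w • s n (v + w) ∂μ :=
        integral_congr_ae (Filter.Eventually.of_forall fun w ↦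
          ((hss (v + w)).tsum_const_smul (K w)).symm)
      rw [heq]
      exact h
    · calc ∫ w, ‖K w • s n (v + w)‖ ∂μ ≤ ∫ w, K w * (r ^ n * C) ∂μ := by
            refine integral_mono (hint n).norm
              ((hK.contDiff.continuous.integrable_of_hasCompactSupport hK.hasCompactSupport).mul_const _) fun w ↦ ?_
            simp only [norm_smul, Real.norm_of_nonneg (hK.nonneg w)]
            exact mul_le_mul_of_nonneg_left (hsb n _) (hK.nonneg w)
        _ = r ^ n * C := by rw [integral_mul_const, hK.integral_eq_one, one_mul]
  have hTsn : ∀ n v, T (s n) v = d (n + 1) v - d n 0 := fun n v ↦ by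
    simp only [T, s]
    rw [hK.average_sub (hdc n) continuous_const, hK.average_const, hds]
  refine ⟨fun v ↦ g₀ v + ∑' n, s n v, T (fun v ↦ g₀ v + ∑' n, s n v) 0 - (g₀ 0 + ∑' n, s n 0),
    hg₀.add hSc, fun l v ↦ ?_, fun v ↦ ?_⟩
  · have : ∀ n, s n (v + l) = s n v := fun n ↦ by simp only [s]; rw [hdp n l l.2]
    simp only [this]
    rw [hinc]; ring
  · have hT : ∀ v, T (fun v ↦ g₀ v + ∑' n, s n v) v = T g₀ v + ∑' n, (d (n + 1) v - d n 0) := by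
      intro v
      simp only [T]
      rw [hK.average_add hg₀ hSc]
      congr 1
      refine (hTs v).tsum_eq.symm.trans ?_
      simp_rw [hTsn]
    have hsum : ∀ v, Summable fun n ↦ d (n + 1) v - d n 0 := fun v ↦ by
      have := (hTs v).summable
      simpa only [hTsn] using this
    have h1 : ∑' n, (d (n + 1) v - d n 0) - ∑' n, (d (n + 1) 0 - d n 0) = ∑' n, s (n + 1) v := by
      rw [← (hsum v).tsum_sub (hsum 0)]
      simp [s]
    have h2 := (hss v).tsum_eq_zero_add
    have h3 : ∑' n, s n 0 = 0 := by simp [s]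
    have h4 : s 0 v = T g₀ v - g₀ v - (T g₀ 0 - g₀ 0) := rfl
    change T (fun v ↦ g₀ v + ∑' n, s n v) v = _
    simp only
    rw [hT, hT, h3, h2, h4, ← h1]
    ring

/-- The Hodge-theoretic fact that every class in `H¹(V / Λ, 𝒪)` comes from `H¹(V / Λ, ℂ)`: a
cocycle of entire functions is constant up to the increments of an entire function. -/
theorem exists_differentiable_increments (Λ : Submodule ℤ V) [DiscreteTopology Λ] [IsZLattice ℝ Λ]
    (a : Λ → V → ℂ) (ha : ∀ l, Differentiable ℂ (a l))
    (hadd : ∀ l m v, a (l + m) v = a l (v + m) + a m v) :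
    ∃ (h : V → ℂ) (c : Λ → ℂ), Differentiable ℂ h ∧ ∀ (l : Λ) v, a l v = h (v + l) - h v + c l := by
  have : FiniteDimensional ℝ V := FiniteDimensional.complexToReal V
  let _ : MeasurableSpace V := borel V
  have : BorelSpace V := ⟨rfl⟩
  let μ : Measure V := Measure.addHaar
  obtain ⟨K, hK, r, hr0, hr1, hr⟩ := exists_contracting_rotationKernel μ Λ
  obtain ⟨g₀, hg₀, hinc₀⟩ := exists_continuous_increments Λ a (fun l ↦ (ha l).continuous) hadd
  obtain ⟨g, c, hgc, hinc, hgK⟩ := exists_average_eq_add_const Λ hK hr0 hr1 hr a ha hg₀ hinc₀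
  have hg : ContDiff ℝ 1 g := by
    have h1 : g = fun v ↦ average μ K g v - c := by
      funext v; rw [hgK, add_sub_cancel_right]
    rw [h1]
    exact (hK.contDiff_average hgc).sub contDiff_const
  have hgd : Differentiable ℝ g := hg.differentiable one_ne_zero
  have hD : ∀ x, Continuous fun v ↦ fderiv ℝ g v x := fun x ↦
    (hg.continuous_fderiv one_ne_zero).clm_apply continuous_const
  have hTD : ∀ v x, average μ K (fun y ↦ fderiv ℝ g y x) v = fderiv ℝ g v x := fun v x ↦ by
    rw [← hK.fderiv_average hg, show average μ K g = fun v ↦ g v + c from funext hgK,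
      fderiv_add_const]
  -- `q x v` is the derivative of `g` at `v` in the antiholomorphic direction `x`.
  let q : V → V → ℂ := fun x v ↦ fderiv ℝ g v x + Complex.I * fderiv ℝ g v (Complex.I • x)
  have hqc : ∀ x, Continuous (q x) := fun x ↦ (hD x).add (continuous_const.mul (hD _))
  have hqT : ∀ x v, average μ K (q x) v = q x v := fun x v ↦ by
    simp only [q]
    rw [hK.average_add (hD x) (h := fun v ↦ Complex.I * fderiv ℝ g v (Complex.I • x))
      (continuous_const.mul (hD _)), hTD]
    congr 1
    rw [← hTD]
    simp only [average, ← integral_const_mul]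
    congr 1
    funext w
    rw [mul_smul_comm]
  have hqp : ∀ x, ∀ l ∈ Λ, ∀ v, q x (v + l) = q x v := fun x l hl v ↦ by
    have h1 : fderiv ℝ g (v + l) = fderiv ℝ g v + fderiv ℝ (a ⟨l, hl⟩) v := by
      rw [← fderiv_comp_add_right, ← fderiv_add (hgd v) (((ha _).restrictScalars ℝ) v)]
      congr 1
      funext y
      exact hinc ⟨l, hl⟩ y
    have h2 : fderiv ℝ (a ⟨l, hl⟩) v = (fderiv ℂ (a ⟨l, hl⟩) v).restrictScalars ℝ :=
      (ha _ v).fderiv_restrictScalars ℝ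
    simp only [q]
    rw [h1, h2]
    simp only [add_apply, ContinuousLinearMap.coe_restrictScalars', map_smul,
      smul_eq_mul]
    linear_combination (fderiv ℂ (a ⟨l, hl⟩) v x) * Complex.I_mul_I
  have hqconst : ∀ x v v', q x v = q x v' := by
    intro x v v'
    obtain ⟨C, hC⟩ := exists_oscillation_bound Λ (hqc x) (hqp x)
    have hpow : ∀ n : ℕ, ∀ v v', ‖q x v - q x v'‖ ≤ r ^ n * C := by
      intro n
      induction n with
      | zero => simpa using hC
      | succ n ih =>
        intro v v'
        have := hr (q x) (hqc x) (hqp x) _ ih v v'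
        rwa [hqT, hqT, ← mul_assoc, ← pow_succ'] at this
    have hlim : Filter.Tendsto (fun n : ℕ ↦ r ^ n * C) Filter.atTop (𝓝 0) := by
      simpa using (tendsto_pow_atTop_nhds_zero_of_lt_one hr0 hr1).mul_const C
    have := ge_of_tendsto' hlim fun n ↦ hpow n v v'
    exact sub_eq_zero.1 (norm_le_zero_iff.1 this)
  -- The antilinear part of `g`.
  let A : V →L[ℝ] ℂ := (2⁻¹ : ℝ) • (fderiv ℝ g 0 + (Complex.I • ContinuousLinearMap.id ℝ ℂ).comp
    ((fderiv ℝ g 0).comp ((Complex.I • ContinuousLinearMap.id ℂ V).restrictScalars ℝ)))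
  have hA : ∀ x, A x = (2⁻¹ : ℝ) • q x 0 := fun x ↦ by simp [A, q]
  refine ⟨fun v ↦ g v - A v, fun l ↦ A l, fun v ↦ ?_, fun l v ↦ ?_⟩
  · have hd : HasFDerivAt (fun v ↦ g v - A v) (fderiv ℝ g v - A) v :=
      (hgd v).hasFDerivAt.sub A.hasFDerivAt
    have hI : ∀ x, (fderiv ℝ g v - A) (Complex.I • x) = Complex.I • (fderiv ℝ g v - A) x := by
      intro x
      simp only [sub_apply, hA]
      rw [hqconst x 0 v, hqconst (Complex.I • x) 0 v]
      have hII : Complex.I • Complex.I • x = -x := by rw [smul_smul, Complex.I_mul_I, neg_one_smul]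
      simp only [q, hII, map_neg, Complex.real_smul, smul_eq_mul]
      push_cast
      linear_combination (1 / 2 : ℂ) * (fderiv ℝ g v (Complex.I • x)) * Complex.I_mul_I
    let D : V →L[ℂ] ℂ :=
      { toFun := fun x ↦ (fderiv ℝ g v - A) x
        map_add' := map_add (fderiv ℝ g v - A)
        map_smul' := fun z x ↦ by
          have hz : z • x = z.re • x + z.im • (Complex.I • x) := by
            conv_lhs => rw [← Complex.re_add_im z]
            rw [add_smul, mul_smul, Complex.coe_smul, Complex.coe_smul]
          rw [hz, map_add, map_smul, map_smul, hI]
          conv_rhs => rw [RingHom.id_apply, ← Complex.re_add_im z]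
          simp only [Complex.real_smul, smul_eq_mul]
          ring
        cont := (fderiv ℝ g v - A).continuous }
    have hD' : HasFDerivAt (𝕜 := ℂ) (fun v ↦ g v - A v) D v :=
      hasFDerivAt_of_restrictScalars ℝ hd (by ext x; rfl)
    exact hD'.differentiableAt
  · simp only
    rw [hinc, map_add]; ring

end Cohomology

/-! ### Symmetric cocycles on free abelian groups -/

section Splitting

/-- The underlying set of the extension of an abelian group by `ℂ` determined by a `2`-cocycle. -/
@[ext] structure TwistedPair (Λ : Type*) where
  base : Λ
  fibre : ℂ

/-- A symmetric `2`-cocycle on a free abelian group is a coboundary, since the abelian extension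
which it defines splits. -/
theorem exists_eq_coboundary_of_symmetric {Λ : Type*} [AddCommGroup Λ] [Module.Free ℤ Λ]
    (n : Λ → Λ → ℂ) (hsymm : ∀ l m, n l m = n m l)
    (hn : ∀ l m k, n l m + n (l + m) k = n m k + n l (m + k)) :
    ∃ c : Λ → ℂ, ∀ l m, c (l + m) = c l + c m + n l m := by
  have h0 : ∀ k, n 0 k = n 0 0 := fun k ↦ by
    have := hn 0 0 k
    simp only [add_zero, zero_add] at this
    linear_combination -this
  let : Add (TwistedPair Λ) := ⟨fun x y ↦ ⟨x.base + y.base, x.fibre + y.fibre + n x.base y.base⟩⟩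
  let : Zero (TwistedPair Λ) := ⟨⟨0, -n 0 0⟩⟩
  let : Neg (TwistedPair Λ) := ⟨fun x ↦ ⟨-x.base, -x.fibre - n (-x.base) x.base - n 0 0⟩⟩
  have hb : ∀ x y : TwistedPair Λ, (x + y).base = x.base + y.base := fun _ _ ↦ rfl
  have hf : ∀ x y : TwistedPair Λ, (x + y).fibre = x.fibre + y.fibre + n x.base y.base :=
    fun _ _ ↦ rfl
  let G : AddGroup (TwistedPair Λ) := AddGroup.ofLeftAxioms
    (fun x y z ↦ by
      ext
      · simp only [hb]; abel
      · simp only [hf, hb]; linear_combination hn x.base y.base z.base)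
    (fun x ↦ by
      ext
      · rw [hb]; exact zero_add _
      · rw [hf]
        change -n 0 0 + x.fibre + n 0 x.base = _
        rw [h0 x.base]; ring)
    (fun x ↦ by
      ext
      · rw [hb]; exact neg_add_cancel _
      · rw [hf]
        change -x.fibre - n (-x.base) x.base - n 0 0 + x.fibre + n (-x.base) x.base = -n 0 0
        ring)
  let : AddCommGroup (TwistedPair Λ) :=
    { G with
      add_comm := fun x y ↦ by
        ext
        · simp only [hb]; abel
        · simp only [hf]; rw [hsymm]; ring }
  let proj : TwistedPair Λ →+ Λ := AddMonoidHom.mk' TwistedPair.base hb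
  obtain ⟨s, hs⟩ := Module.projective_lifting_property proj.toIntLinearMap LinearMap.id
    fun l ↦ ⟨⟨l, 0⟩, rfl⟩
  have hsb : ∀ l, (s l).base = l := fun l ↦ LinearMap.congr_fun hs l
  refine ⟨fun l ↦ (s l).fibre, fun l m ↦ ?_⟩
  simp only
  rw [map_add, hf, hsb, hsb]

/-- Functions `a l`, indexed by a free group of translations, which satisfy the cocycle condition
up to constants and whose mutual increments agree, become a cocycle after adding constants. -/
theorem exists_add_const_cocycle {V : Type*} [AddCommGroup V] (Λ : Submodule ℤ V)
    [Module.Free ℤ Λ] (a : Λ → V → ℂ)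
    (hcomm : ∀ (l m : Λ) v, a m (v + l) + a l v = a l (v + m) + a m v)
    (hconst : ∀ (l m : Λ) v, a (l + m) v - a l (v + m) - a m v = a (l + m) 0 - a l m - a m 0) :
    ∃ c : Λ → ℂ, ∀ (l m : Λ) v, a (l + m) v + c (l + m) = a l (v + m) + c l + (a m v + c m) := by
  have hsymm : ∀ l m : Λ, -(a (l + m) 0 - a l m - a m 0) = -(a (m + l) 0 - a m l - a l 0) :=
    fun l m ↦ by
      have := hcomm l m 0
      simp only [zero_add] at this
      rw [add_comm m l]
      linear_combination -this
  obtain ⟨c, hc⟩ := exists_eq_coboundary_of_symmetric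
    (fun l m ↦ -(a (l + m) 0 - a l m - a m 0)) hsymm fun l m k ↦ by
      rw [← hconst l m (k : V), add_assoc l m k, show ((m + k : Λ) : V) = k + m by
        push_cast; rw [add_comm]]
      ring_nf
  exact ⟨c, fun l m v ↦ by rw [hc]; linear_combination hconst l m v⟩

end Splitting

/-! ### The Hermitian form and its theta functions -/

namespace PrincipalPolarization

variable {V : Type*} [NormedAddCommGroup V] [NormedSpace ℂ V] {Λ : Submodule ℤ V}

theorem form_neg_swap (θ : PrincipalPolarization Λ) (v w : V) : θ.form v w = -θ.form w v := by
  have h := θ.alt (v + w)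
  simp only [map_add, LinearMap.add_apply, θ.alt] at h
  linarith

/-- The Hermitian form `H(v, w) = E(iv, w) + i E(v, w)` of a principal polarization, as a
`ℂ`-linear form in `v` for fixed `w`. -/
noncomputable def herm (θ : PrincipalPolarization Λ) (w : V) : V →ₗ[ℂ] ℂ where
  toFun v := θ.form (Complex.I • v) w + Complex.I * θ.form v w
  map_add' v v' := by
    simp only [smul_add, map_add, LinearMap.add_apply]
    push_cast
    ring
  map_smul' z v := by
    have hz : ∀ x : V, z • x = z.re • x + z.im • (Complex.I • x) := fun x ↦ by
      conv_lhs => rw [← Complex.re_add_im z]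
      rw [add_smul, mul_smul, Complex.coe_smul, Complex.coe_smul]
    have hII : Complex.I • Complex.I • v = -v := by
      rw [smul_smul, Complex.I_mul_I, neg_one_smul]
    rw [smul_comm, hz, hz, hII]
    simp only [map_add, map_smul, map_neg, LinearMap.add_apply, LinearMap.smul_apply,
      LinearMap.neg_apply, smul_eq_mul, RingHom.id_apply]
    conv_rhs => rw [← Complex.re_add_im z]
    push_cast
    linear_combination (-(z.im : ℂ)) * θ.form v w * Complex.I_mul_I

theorem herm_apply (θ : PrincipalPolarization Λ) (v w : V) :
    θ.herm w v = θ.form (Complex.I • v) w + Complex.I * θ.form v w := rfl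

theorem herm_add (θ : PrincipalPolarization Λ) (v w w' : V) :
    θ.herm (w + w') v = θ.herm w v + θ.herm w' v := by
  simp only [herm_apply, map_add]
  push_cast
  ring

theorem form_I_symm (θ : PrincipalPolarization Λ) (v w : V) :
    θ.form (Complex.I • v) w = θ.form (Complex.I • w) v := by
  rw [← θ.map_I, smul_smul, Complex.I_mul_I, neg_one_smul, map_neg, LinearMap.neg_apply,
    form_neg_swap, neg_neg]

/-- The imaginary part of the Hermitian form is the alternating form. -/
theorem herm_sub_herm (θ : PrincipalPolarization Λ) (v w : V) :
    θ.herm w v - θ.herm v w = 2 * Complex.I * θ.form v w := by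
  simp only [herm_apply]
  rw [θ.form_I_symm v w, θ.form_neg_swap w v]
  push_cast
  ring

/-- The theta functions of the line bundle of class `2θ` with trivial semicharacter: the entire
functions which satisfy the functional equation of the canonical factor of automorphy of this
bundle. -/
noncomputable def thetaSpace (θ : PrincipalPolarization Λ) : Submodule ℂ (V → ℂ) where
  carrier := {ϕ | Differentiable ℂ ϕ ∧ ∀ l ∈ Λ, ∀ v, ϕ (v + l) =
    Complex.exp (2 * Real.pi * θ.herm l v + Real.pi * θ.herm l l) * ϕ v}
  add_mem' := fun hϕ hψ ↦ ⟨hϕ.1.add hψ.1, fun l hl v ↦ by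
    simp only [Pi.add_apply, hϕ.2 l hl v, hψ.2 l hl v, mul_add]⟩
  zero_mem' := ⟨differentiable_const 0, fun l hl v ↦ by simp⟩
  smul_mem' := fun c ϕ hϕ ↦ ⟨hϕ.1.const_smul c, fun l hl v ↦ by
    simp only [Pi.smul_apply, hϕ.2 l hl v, smul_eq_mul, mul_left_comm]⟩

end PrincipalPolarization

/-! ### Maps to projective space given by theta functions -/

section Normalization

variable {V : Type*} [NormedAddCommGroup V] [NormedSpace ℂ V]

theorem eq_of_exp_two_pi_I_mul_eq_one {F : V → ℂ} (hF : Differentiable ℂ F)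
    (h : ∀ v, Complex.exp (2 * (Real.pi : ℂ) * Complex.I * F v) = 1) (v w : V) : F v = F w := by
  refine is_const_of_fderiv_eq_zero (𝕜 := ℂ) hF (fun v ↦ ?_) v w
  have h1 : HasFDerivAt (fun v ↦ Complex.exp (2 * (Real.pi : ℂ) * Complex.I * F v))
      (Complex.exp (2 * (Real.pi : ℂ) * Complex.I * F v) •
        ((2 * (Real.pi : ℂ) * Complex.I) • fderiv ℂ F v)) v :=
    ((hF v).hasFDerivAt.const_mul _).cexp
  have h2 := h1.unique ((hasFDerivAt_const (1 : ℂ) v).congr_of_eventuallyEq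
    (Filter.Eventually.of_forall h))
  rw [h, one_smul] at h2
  exact (smul_eq_zero.1 h2).resolve_left Complex.two_pi_I_ne_zero

/-- A nowhere vanishing entire function which the lattice multiplies by constants is the
exponential of a linear form. -/
theorem exists_eq_exp_of_multipliers [FiniteDimensional ℂ V] (Λ : Submodule ℤ V)
    [DiscreteTopology Λ] [IsZLattice ℝ Λ] {u : V → ℂ} (hu : Differentiable ℂ u)
    (hu0 : ∀ v, u v ≠ 0) (h1 : u 0 = 1) (χ : Λ → ℂ) (hχ : ∀ (l : Λ) v, u (v + l) = χ l * u v) :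
    ∃ lam : V →L[ℂ] ℂ, ∀ v, u v = Complex.exp (lam v) := by
  have hmul : ∀ v w, u (v + w) = u v * u w := fun v w ↦ by
    have hχ0 : ∀ l, χ l ≠ 0 := fun l h ↦ by
      have := hχ l 0
      rw [h, zero_mul] at this
      exact hu0 _ this
    have hp : Differentiable ℂ fun v ↦ u (v + w) / u v := by
      simp only [div_eq_mul_inv]
      exact (hu.comp (differentiable_id.add_const w)).mul (hu.inv hu0)
    have := eq_of_differentiable_of_periodic Λ hp (fun l hl v ↦ by
      rw [add_right_comm, hχ ⟨l, hl⟩, hχ ⟨l, hl⟩, mul_div_mul_left _ _ (hχ0 _)]) v 0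
    rw [h1, zero_add, div_one, div_eq_iff (hu0 v)] at this
    rw [this, mul_comm]
  let lam := fderiv ℂ u 0
  have hder : ∀ v, HasFDerivAt u (u v • lam) v := fun v ↦ by
    have h2 : HasFDerivAt (fun w ↦ u v * u (w - v)) (u v • lam) v := by
      have h3 : HasFDerivAt u lam (v - v) := by rw [sub_self]; exact (hu 0).hasFDerivAt
      have h4 : HasFDerivAt (fun w ↦ u (w - v)) lam v := by
        exact HasFDerivAt.comp (f := fun w ↦ w - v) v h3 ((hasFDerivAt_id v).sub_const v)
      exact h4.const_mul _
    refine h2.congr_of_eventuallyEq (Filter.Eventually.of_forall fun w ↦ ?_)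
    simp only
    rw [← hmul, add_sub_cancel]
  refine ⟨lam, fun v ↦ ?_⟩
  have hF : ∀ v, HasFDerivAt (fun v ↦ u v * Complex.exp (-lam v)) (0 : V →L[ℂ] ℂ) v := fun v ↦ by
    have h5 := (hder v).mul (lam.hasFDerivAt.neg.cexp (x := v))
    have h6 : u v • Complex.exp ((-⇑lam) v) • -lam + Complex.exp ((-⇑lam) v) • u v • lam = 0 := by
      rw [smul_comm, smul_neg, smul_neg, neg_add_cancel]
    rw [h6] at h5
    exact h5
  have hc := is_const_of_fderiv_eq_zero (𝕜 := ℂ) (fun v ↦ (hF v).differentiableAt)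
    (fun v ↦ (hF v).fderiv) v 0
  simp only [h1, map_zero, neg_zero, Complex.exp_zero, mul_one] at hc
  rw [Complex.exp_neg, ← div_eq_mul_inv, div_eq_one_iff_eq (Complex.exp_ne_zero _)] at hc
  exact hc

/-- The theorem of Appell and Humbert, up to constants: after multiplication by a nowhere
vanishing entire function, a lift of a map of class `2θ` has factors of automorphy which are
constant multiples of the canonical ones. -/
theorem exists_lift_with_exponential_factors [FiniteDimensional ℂ V] {n : ℕ} {Λ : Submodule ℤ V}
    [DiscreteTopology Λ] [IsZLattice ℝ Λ] (θ : PrincipalPolarization Λ)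
    (π : V ⧸ Λ → ProjSpace n) (hθ : PullbackO1HasClass π ((2 : ℝ) • θ.form)) :
    ∃ (Φ : V → Fin (n + 1) → ℂ) (κ : Λ → ℂ), Differentiable ℂ Φ ∧ IsLiftOn π Set.univ Φ ∧
      ∀ (l : Λ) v, Φ (v + l) = Complex.exp (2 * Real.pi * θ.herm l v + κ l) • Φ v := by
  have : FiniteDimensional ℝ V := FiniteDimensional.complexToReal V
  have : Module.Free ℤ Λ := ZLattice.module_free ℝ Λ
  obtain ⟨Φ, f, hΦ, hlift, hf, hauto, hE⟩ := hθ
  have hΦ0 : ∀ v, Φ v ≠ 0 := fun v ↦ (hlift v trivial).1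
  have hherm : ∀ l, Differentiable ℂ (θ.herm l) := fun l ↦
    (LinearMap.toContinuousLinearMap (θ.herm l)).differentiable
  have hfconst : ∀ (l m : Λ) v, f (l + m) v - f l (v + m) - f m v
      = f (l + m) 0 - f l m - f m 0 := fun l m v ↦ by
    have hd : Differentiable ℂ fun v ↦ f (l + m) v - f l (v + m) - f m v :=
      ((hf _).sub ((hf l).comp (differentiable_id.add_const _))).sub (hf m)
    have := eq_of_exp_two_pi_I_mul_eq_one hd (fun v ↦ ?_) v 0
    · simpa using this
    · have h1 := hauto (l + m) v
      have h2 : v + ((l + m : Λ) : V) = v + m + l := by push_cast; abel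
      rw [h2, hauto l, hauto m, smul_smul] at h1
      have h3 := smul_left_injective ℂ (hΦ0 v) h1
      rw [mul_sub, mul_sub, Complex.exp_sub, Complex.exp_sub, ← h3]
      field_simp
  -- The canonical logarithmic factors of class `2θ` are `-i H(v, l)` up to constants.
  let a : Λ → V → ℂ := fun l v ↦ f l v + Complex.I * θ.herm l v
  have ha : ∀ l, Differentiable ℂ (a l) := fun l ↦ (hf l).add ((hherm l).const_mul _)
  obtain ⟨c, hc⟩ := exists_add_const_cocycle Λ a (fun (l m : Λ) v ↦ by
    have h1 := hE l m v
    have h2 := θ.herm_sub_herm (l : V) (m : V)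
    simp only [LinearMap.smul_apply, smul_eq_mul] at h1
    push_cast at h1
    simp only [a, map_add]
    linear_combination h1 + Complex.I * h2 + 2 * (θ.form l m) * Complex.I_mul_I)
    (fun l m v ↦ by
      simp only [a, map_add, map_zero, Submodule.coe_add, PrincipalPolarization.herm_add]
      linear_combination hfconst l m v)
  obtain ⟨h, d, hh, hd⟩ := exists_differentiable_increments Λ (fun l v ↦ a l v + c l)
    (fun l ↦ (ha l).add_const _) hc
  refine ⟨fun v ↦ Complex.exp (-(2 * (Real.pi : ℂ) * Complex.I * h v)) • Φ v,
    fun l ↦ 2 * (Real.pi : ℂ) * Complex.I * (d l - c l), ?_, fun v _ ↦ ?_, fun l v ↦ ?_⟩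
  · exact ((hh.const_mul _).neg.cexp).smul hΦ
  · refine ⟨smul_ne_zero (Complex.exp_ne_zero _) (hΦ0 v), ?_⟩
    rw [(hlift v trivial).2]
    exact (Projectivization.mk_eq_mk_iff' ℂ _ _ _ _).2
      ⟨Complex.exp (2 * (Real.pi : ℂ) * Complex.I * h v), by
        rw [smul_smul, ← Complex.exp_add, add_neg_cancel, Complex.exp_zero, one_smul]⟩
  · simp only
    rw [hauto, smul_smul, smul_smul, ← Complex.exp_add, ← Complex.exp_add]
    congr 2
    have h1 := hd l v
    simp only [a] at h1
    linear_combination 2 * (Real.pi : ℂ) * Complex.I * h1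
      - 2 * (Real.pi : ℂ) * θ.herm l v * Complex.I_mul_I

/-- If `π : V / Λ → ℙⁿ` has class `2θ` and is invariant under `-id`, then it is given by theta
functions with trivial semicharacter: the lift can be made even, and comparing its values at the
half period `l / 2` and at `-l / 2` shows that the factor of automorphy at `l` is the canonical
one. -/
theorem exists_lift_mem_thetaSpace [FiniteDimensional ℂ V] {n : ℕ} {Λ : Submodule ℤ V}
    [DiscreteTopology Λ] [IsZLattice ℝ Λ] (θ : PrincipalPolarization Λ)
    (π : V ⧸ Λ → ProjSpace n) (hπ : ∀ x, π (-x) = π x)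
    (hθ : PullbackO1HasClass π ((2 : ℝ) • θ.form)) :
    ∃ Ψ : V → Fin (n + 1) → ℂ, (∀ i, (fun v ↦ Ψ v i) ∈ θ.thetaSpace) ∧
      IsLiftOn π Set.univ Ψ := by
  obtain ⟨Φ, κ, hΦ, hlift, hauto⟩ := exists_lift_with_exponential_factors θ π hθ
  have hΦ0 : ∀ v, Φ v ≠ 0 := fun v ↦ (hlift v trivial).1
  have hΦi : ∀ i, Differentiable ℂ fun v ↦ Φ v i := fun i v ↦ differentiableAt_pi.1 (hΦ v) i
  have hex : ∀ v, ∃ c : ℂ, Φ (-v) = c • Φ v := fun v ↦ by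
    have h1 := (hlift v trivial).2
    have h2 := (hlift (-v) trivial).2
    rw [Submodule.Quotient.mk_neg, hπ, h1] at h2
    obtain ⟨c, hc⟩ := (Projectivization.mk_eq_mk_iff' ℂ _ _ _ _).1 h2.symm
    exact ⟨c, hc.symm⟩
  choose u hu using hex
  have hu0 : ∀ v, u v ≠ 0 := fun v h ↦ hΦ0 (-v) (by rw [hu, h, zero_smul])
  have hud : Differentiable ℂ u := fun v ↦ by
    obtain ⟨i, hi⟩ := Function.ne_iff.1 (hΦ0 v)
    have hd : DifferentiableAt ℂ (fun w ↦ Φ (-w) i / Φ w i) v := by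
      simp only [div_eq_mul_inv]
      exact ((hΦi i).comp differentiable_id.neg v).mul ((hΦi i v).inv hi)
    refine hd.congr_of_eventuallyEq ?_
    filter_upwards [(hΦi i).continuous.continuousAt.eventually_ne hi] with w hw
    rw [hu, Pi.smul_apply, smul_eq_mul, mul_div_cancel_right₀ _ hw]
  have hu1 : u 0 = 1 := by
    have h1 := hu 0
    rw [neg_zero] at h1
    exact smul_left_injective ℂ (hΦ0 0) (by simpa using h1.symm)
  have huχ : ∀ (l : Λ) v, u (v + l) =
      Complex.exp (2 * Real.pi * θ.herm l l - 2 * κ l) * u v := fun l v ↦ by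
    have h1 : Φ (-v) = Φ (-(v + l) + l) := by congr 1; abel
    rw [hauto, hu, hu, hauto, smul_smul, smul_smul] at h1
    rw [smul_left_injective ℂ (hΦ0 v) h1, map_neg, map_add]
    have h2 : Complex.exp (2 * Real.pi * θ.herm l l - 2 * κ l) *
        Complex.exp (2 * Real.pi * -(θ.herm l v + θ.herm l l) + κ l) *
        Complex.exp (2 * Real.pi * θ.herm l v + κ l) = 1 := by
      rw [← Complex.exp_add, ← Complex.exp_add, ← Complex.exp_zero]
      congr 1
      ring
    linear_combination -(u (v + l)) * h2
  obtain ⟨lam, hlam⟩ := exists_eq_exp_of_multipliers Λ hud hu0 hu1 _ huχ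
  let Ψ : V → Fin (n + 1) → ℂ := fun v ↦ Complex.exp (lam v / 2) • Φ v
  have hΨ0 : ∀ v, Ψ v ≠ 0 := fun v ↦ smul_ne_zero (Complex.exp_ne_zero _) (hΦ0 v)
  have hΨd : Differentiable ℂ Ψ := by
    have : Differentiable ℂ fun v ↦ Complex.exp (lam v / 2) :=
by
      simp only [div_eq_mul_inv]
      exact (lam.differentiable.mul_const (2 : ℂ)⁻¹).cexp
    exact this.smul hΦ
  have hΨeven : ∀ v, Ψ (-v) = Ψ v := fun v ↦ by
    simp only [Ψ]
    rw [hu, hlam, smul_smul, ← Complex.exp_add, map_neg]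
    congr 2
    ring
  have hΨauto : ∀ (l : Λ) v, Ψ (v + l) =
      Complex.exp (2 * Real.pi * θ.herm l v + (κ l + lam l / 2)) • Ψ v := fun l v ↦ by
    simp only [Ψ]
    rw [hauto, smul_smul, smul_smul, ← Complex.exp_add, ← Complex.exp_add, map_add]
    congr 2
    ring
  have hhalf : ∀ l : Λ, Complex.exp (κ l + lam l / 2) = Complex.exp (Real.pi * θ.herm l l) :=
    fun l ↦ by
    have h1 := hΨauto l (-((2 : ℂ)⁻¹ • (l : V)))
    have h2 : -((2 : ℂ)⁻¹ • (l : V)) + l = (2 : ℂ)⁻¹ • (l : V) := by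
      have : (l : V) = (2 : ℂ)⁻¹ • (l : V) + (2 : ℂ)⁻¹ • (l : V) := by
        rw [← add_smul]; norm_num
      nth_rewrite 2 [this]
      abel
    rw [h2, hΨeven] at h1
    have h3 : Complex.exp (2 * Real.pi * θ.herm l (-((2 : ℂ)⁻¹ • (l : V))) +
        (κ l + lam l / 2)) = 1 :=
      smul_left_injective ℂ (hΨ0 ((2 : ℂ)⁻¹ • (l : V))) (by simpa using h1.symm)
    rw [map_neg, map_smul, smul_eq_mul] at h3
    calc Complex.exp (κ l + lam l / 2)
        = Complex.exp (Real.pi * θ.herm l l) *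
          Complex.exp (2 * Real.pi * -(2⁻¹ * θ.herm l l) + (κ l + lam l / 2)) := by
          rw [← Complex.exp_add]; congr 1; ring
      _ = Complex.exp (Real.pi * θ.herm l l) := by rw [h3, mul_one]
  refine ⟨Ψ, fun i ↦ ⟨fun v ↦ differentiableAt_pi.1 (hΨd v) i, fun l hl v ↦ ?_⟩, fun v _ ↦
    ⟨hΨ0 v, ?_⟩⟩
  · have h1 := congrFun (hΨauto ⟨l, hl⟩ v) i
    rw [Complex.exp_add, hhalf, ← Complex.exp_add] at h1
    exact h1
  · rw [(hlift v trivial).2]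
    exact (Projectivization.mk_eq_mk_iff' ℂ _ _ _ _).2 ⟨Complex.exp (-(lam v / 2)), by
      simp only [Ψ]
      rw [smul_smul, ← Complex.exp_add, neg_add_cancel, Complex.exp_zero, one_smul]⟩

end Normalization

/-! ### Fourier coefficients of quasi-periodic functions -/

section Fourier

open MeasureTheory

/-- The integral of an entire function of period one over a horizontal unit segment does not
depend on the segment. -/
theorem integral_translate_of_periodic {F : ℂ → ℂ} (hF : Differentiable ℂ F)
    (hper : ∀ z, F (z + 1) = F z) (w : ℂ) :
    ∫ x in (0 : ℝ)..1, F (x + w) = ∫ x in (0 : ℝ)..1, F x := by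
  obtain ⟨P, hP⟩ := hF.isExactOn_univ
  have hP' : ∀ z, HasDerivAt P (F z) z := fun z ↦ hP z trivial
  have hint : ∀ w : ℂ, ∫ x in (0 : ℝ)..1, F (x + w) = P (w + 1) - P w := fun w ↦ by
    have h1 : ∀ x : ℝ, HasDerivAt (fun x : ℝ ↦ P (x + w)) (F (x + w)) x := fun x ↦
      ((hP' _).comp_add_const _ w).comp_ofReal
    have hc : Continuous fun x : ℝ ↦ F (x + w) :=
      hF.continuous.comp (Complex.continuous_ofReal.add continuous_const)
    rw [intervalIntegral.integral_eq_sub_of_hasDerivAt (fun x _ ↦ h1 x)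
      (hc.intervalIntegrable _ _)]
    simp [add_comm]
  have hd : ∀ w, HasDerivAt (fun w ↦ P (w + 1) - P w) 0 w := fun w ↦ by
    have := ((hP' (w + 1)).comp_add_const w 1).sub (hP' w)
    rwa [hper, sub_self] at this
  have hc := is_const_of_deriv_eq_zero (fun w ↦ (hd w).differentiableAt)
    (fun w ↦ (hd w).deriv) w 0
  rw [hint, hc, ← hint]
  simp

/-- A continuous function of period one whose Fourier coefficients vanish is zero. -/
theorem eq_zero_of_fourier_integrals_eq_zero {f : ℝ → ℂ} (hf : Continuous f)
    (hper : ∀ x, f (x + 1) = f x)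
    (h : ∀ n : ℤ, ∫ x in (0 : ℝ)..1, Complex.exp (-(2 * Real.pi * Complex.I * (n * x))) * f x = 0)
    (x : ℝ) : f x = 0 := by
  have hp : Function.Periodic f 1 := hper
  have : Fact ((0 : ℝ) < 1) := ⟨one_pos⟩
  let g : C(AddCircle (1 : ℝ), ℂ) := ⟨hp.lift, continuous_coinduced_dom.2 hf⟩
  have hg : ∀ n, fourierCoeff g n = 0 := fun n ↦ by
    rw [fourierCoeff_eq_intervalIntegral _ _ 0, zero_add, ← h n]
    simp only [div_one, one_smul]
    refine intervalIntegral.integral_congr fun x _ ↦ ?_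
    simp only [fourier_coe_apply, smul_eq_mul]
    change _ * f x = _
    congr 2
    push_cast
    ring
  have hs := has_pointwise_sum_fourier_series_of_summable (f := g)
    (by rw [show fourierCoeff g = 0 from funext hg]; exact summable_zero) (x : AddCircle (1 : ℝ))
  simp only [hg, zero_smul] at hs
  exact hs.unique hasSum_zero

/-- The Fourier coefficients, over the real unit square, of a function of two complex variables. -/
noncomputable def fourierCoeff₂ (G : ℂ → ℂ → ℂ) (n m : ℤ) : ℂ :=
  ∫ x in (0 : ℝ)..1, ∫ y in (0 : ℝ)..1,
    Complex.exp (-(2 * Real.pi * Complex.I * (n * x + m * y))) * G x y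

theorem eq_zero_of_fourierCoeff₂_eq_zero {G : ℂ → ℂ → ℂ}
    (hG : Continuous fun p : ℂ × ℂ ↦ G p.1 p.2)
    (h1 : ∀ x y, G (x + 1) y = G x y) (h2 : ∀ x y, G x (y + 1) = G x y)
    (h : ∀ n m, fourierCoeff₂ G n m = 0) (x y : ℝ) : G x y = 0 := by
  have hG' : Continuous fun p : ℝ × ℝ ↦ G p.1 p.2 :=
    hG.comp ((Complex.continuous_ofReal.comp continuous_fst).prodMk
      (Complex.continuous_ofReal.comp continuous_snd))
  refine eq_zero_of_fourier_integrals_eq_zero (f := fun y : ℝ ↦ G x y)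
    (hG'.comp (by fun_prop : Continuous fun y : ℝ ↦ (x, y)))
    (fun y ↦ by push_cast; exact h2 _ _) (fun m ↦ ?_) y
  refine eq_zero_of_fourier_integrals_eq_zero (f := fun x : ℝ ↦ ∫ y in (0 : ℝ)..1,
    Complex.exp (-(2 * Real.pi * Complex.I * (m * y))) * G x y)
    ?_ (fun x ↦ by push_cast; simp only [h1]) (fun n ↦ ?_) x
  · refine intervalIntegral.continuous_parametric_intervalIntegral_of_continuous' ?_ 0 1
    simp only [Function.uncurry_def]
    exact Continuous.mul (by fun_prop) hG'
  · rw [← h n m, fourierCoeff₂]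
    congr 1
    funext x
    rw [← intervalIntegral.integral_const_mul]
    congr 1
    funext y
    rw [← mul_assoc, ← Complex.exp_add]
    congr 2
    ring

theorem fourierCoeff₂_add {G G' : ℂ → ℂ → ℂ} (hG : Continuous fun p : ℂ × ℂ ↦ G p.1 p.2)
    (hG' : Continuous fun p : ℂ × ℂ ↦ G' p.1 p.2) (n m : ℤ) :
    fourierCoeff₂ (fun x y ↦ G x y + G' x y) n m = fourierCoeff₂ G n m + fourierCoeff₂ G' n m := by
  have hc : ∀ {G : ℂ → ℂ → ℂ}, Continuous (fun p : ℂ × ℂ ↦ G p.1 p.2) →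
      Continuous (Function.uncurry fun x y : ℝ ↦
        Complex.exp (-(2 * Real.pi * Complex.I * (n * x + m * y))) * G x y) := fun {G} hG ↦ by
    have hG2 : Continuous fun p : ℝ × ℝ ↦ G p.1 p.2 :=
      hG.comp ((Complex.continuous_ofReal.comp continuous_fst).prodMk
        (Complex.continuous_ofReal.comp continuous_snd))
    simp only [Function.uncurry_def]
    exact Continuous.mul (by fun_prop) hG2
  have hs : ∀ {f : ℝ → ℝ → ℂ}, Continuous (Function.uncurry f) → ∀ x : ℝ, Continuous (f x) :=
    fun hf x ↦ hf.comp (by fun_prop : Continuous fun y : ℝ ↦ (x, y))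
  simp only [fourierCoeff₂, mul_add (Complex.exp _)]
  rw [← intervalIntegral.integral_add]
  · congr 1
    funext x
    exact intervalIntegral.integral_add ((hs (hc hG) x).intervalIntegrable _ _)
      ((hs (hc hG') x).intervalIntegrable _ _)
  · exact (intervalIntegral.continuous_parametric_intervalIntegral_of_continuous' (hc hG)
      0 1).intervalIntegrable _ _
  · exact (intervalIntegral.continuous_parametric_intervalIntegral_of_continuous' (hc hG')
      0 1).intervalIntegrable _ _

theorem fourierCoeff₂_const_mul (G : ℂ → ℂ → ℂ) (c : ℂ) (n m : ℤ) :
    fourierCoeff₂ (fun x y ↦ c * G x y) n m = c * fourierCoeff₂ G n m := by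
  simp only [fourierCoeff₂, mul_left_comm _ c, intervalIntegral.integral_const_mul]

theorem fourierCoeff₂_exp_mul (G : ℂ → ℂ → ℂ) (j k n m : ℤ) :
    fourierCoeff₂ (fun x y ↦ Complex.exp (2 * Real.pi * Complex.I * (j * x + k * y)) * G x y) n m
      = fourierCoeff₂ G (n - j) (m - k) := by
  simp only [fourierCoeff₂, ← mul_assoc, ← Complex.exp_add]
  congr! 6 with x y
  push_cast
  ring

/-- By Cauchy's theorem, translating an entire function of two variables which is periodic under
the integral lattice multiplies its Fourier coefficients by exponentials. -/
theorem fourierCoeff₂_translate {G : ℂ → ℂ → ℂ} (hG : Differentiable ℂ fun p : ℂ × ℂ ↦ G p.1 p.2)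
    (h1 : ∀ x y, G (x + 1) y = G x y) (h2 : ∀ x y, G x (y + 1) = G x y) (s t : ℂ) (n m : ℤ) :
    fourierCoeff₂ (fun x y ↦ G (x + s) (y + t)) n m
      = Complex.exp (2 * Real.pi * Complex.I * (n * s + m * t)) * fourierCoeff₂ G n m := by
  obtain ⟨P, hP⟩ : ∃ P : ℂ → ℂ → ℂ, ∀ x y, P x y =
      Complex.exp (-(2 * Real.pi * Complex.I * (n * x + m * y))) * G x y := ⟨_, fun _ _ ↦ rfl⟩
  have hPd : Differentiable ℂ fun p : ℂ × ℂ ↦ P p.1 p.2 := by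
    simp only [hP]
    have : Differentiable ℂ fun p : ℂ × ℂ ↦
        Complex.exp (-(2 * Real.pi * Complex.I * (n * p.1 + m * p.2))) := by fun_prop
    exact this.mul hG
  have hP1 : ∀ x y, P (x + 1) y = P x y := fun x y ↦ by
    have : Complex.exp (-(2 * Real.pi * Complex.I * (n * (x + 1) + m * y)))
        = Complex.exp (-(2 * Real.pi * Complex.I * (n * x + m * y))) :=
      Complex.exp_eq_exp_iff_exists_int.2 ⟨-n, by push_cast; ring⟩
    rw [hP, hP, h1, this]
  have hP2 : ∀ x y, P x (y + 1) = P x y := fun x y ↦ by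
    have : Complex.exp (-(2 * Real.pi * Complex.I * (n * x + m * (y + 1))))
        = Complex.exp (-(2 * Real.pi * Complex.I * (n * x + m * y))) :=
      Complex.exp_eq_exp_iff_exists_int.2 ⟨-m, by push_cast; ring⟩
    rw [hP, hP, h2, this]
  have hPx : ∀ y, Differentiable ℂ fun x ↦ P x y := fun y ↦
    hPd.comp (differentiable_id.prodMk (differentiable_const y))
  have hPy : ∀ x, Differentiable ℂ fun y ↦ P x y := fun x ↦
    hPd.comp ((differentiable_const x).prodMk differentiable_id)
  have hswap : ∀ s : ℂ, ∫ x in (0 : ℝ)..1, ∫ y in (0 : ℝ)..1, P (x + s) y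
      = ∫ y in (0 : ℝ)..1, ∫ x in (0 : ℝ)..1, P (x + s) y := fun s ↦ by
    refine intervalIntegral_intervalIntegral_swap ?_
    have hc : Continuous (Function.uncurry fun x y : ℝ ↦ P (x + s) y) :=
      hPd.continuous.comp (((Complex.continuous_ofReal.comp continuous_fst).add
        continuous_const).prodMk (Complex.continuous_ofReal.comp continuous_snd))
    exact (hc.continuousOn.integrableOn_compact
      (isCompact_uIcc.prod isCompact_uIcc)).mono_set
        (Set.prod_mono Set.uIoc_subset_uIcc Set.uIoc_subset_uIcc)
  have key : ∫ x in (0 : ℝ)..1, ∫ y in (0 : ℝ)..1, P (x + s) (y + t)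
      = ∫ x in (0 : ℝ)..1, ∫ y in (0 : ℝ)..1, P x y := by
    simp_rw [fun x : ℝ ↦ integral_translate_of_periodic (hPy (x + s)) (hP2 (x + s)) t]
    have h0 := hswap 0
    simp only [add_zero] at h0
    rw [hswap s, h0]
    simp_rw [fun y : ℝ ↦ integral_translate_of_periodic (hPx y) (fun x ↦ hP1 x y) s]
  have hrw : fourierCoeff₂ G n m = ∫ x in (0 : ℝ)..1, ∫ y in (0 : ℝ)..1, P x y := by
    simp only [hP, fourierCoeff₂]
  rw [hrw, ← key, fourierCoeff₂, ← intervalIntegral.integral_const_mul]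
  congr 1
  funext x
  rw [← intervalIntegral.integral_const_mul]
  congr 1
  funext y
  rw [hP, ← mul_assoc, ← Complex.exp_add]
  congr 2
  ring

theorem forall_int_of_step_two {p : ℤ → Prop} (h0 : p 0) (h1 : p 1)
    (hstep : ∀ n, p n ↔ p (n - 2)) (n : ℤ) : p n := by
  have h : ∀ k : ℕ, ∀ r : ℤ, p r → p (r + 2 * k) ∧ p (r - 2 * k) := by
    intro k r hr
    induction k with
    | zero => simpa using hr
    | succ k ih =>
      refine ⟨(hstep _).2 ?_, ?_⟩
      · convert ih.1 using 1; push_cast; ring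
      · convert (hstep _).1 ih.2 using 1; push_cast; ring
  have hn : n = n % 2 + 2 * (n / 2) := by omega
  have hr : p (n % 2) := by
    rcases Int.emod_two_eq_zero_or_one n with h | h <;> rw [h] <;> assumption
  rcases Int.natAbs_eq (n / 2) with h' | h'
  · rw [hn, h']; exact (h _ _ hr).1
  · have := (h (n / 2).natAbs _ hr).2
    rw [hn, h']; convert this using 1; ring

/-- Classical theta functions of level two in two variables are determined by four of their
Fourier coefficients: the two quasi-periods relate the coefficients whose indices agree modulo
two. -/
theorem eq_zero_of_quasiperiodic {G : ℂ → ℂ → ℂ}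
    (hG : Differentiable ℂ fun p : ℂ × ℂ ↦ G p.1 p.2)
    (h1 : ∀ x y, G (x + 1) y = G x y) (h2 : ∀ x y, G x (y + 1) = G x y)
    {s t s' t' c c' : ℂ}
    (h3 : ∀ x y, G (x + s) (y + t) = Complex.exp (4 * Real.pi * Complex.I * x + c) * G x y)
    (h4 : ∀ x y, G (x + s') (y + t') = Complex.exp (4 * Real.pi * Complex.I * y + c') * G x y)
    (h : ∀ i j : Fin 2, fourierCoeff₂ G (i : ℕ) (j : ℕ) = 0) (x y : ℂ) : G x y = 0 := by
  have hn : ∀ n m, fourierCoeff₂ G n m = 0 ↔ fourierCoeff₂ G (n - 2) m = 0 := fun n m ↦ by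
    have e1 := fourierCoeff₂_translate hG h1 h2 s t n m
    have e2 : (fun x y ↦ G (x + s) (y + t)) = fun x y ↦ Complex.exp c *
        (Complex.exp (2 * Real.pi * Complex.I * ((2 : ℤ) * x + (0 : ℤ) * y)) * G x y) := by
      funext x y
      rw [h3, ← mul_assoc, ← Complex.exp_add]
      congr 2
      push_cast
      ring
    rw [e2, fourierCoeff₂_const_mul, fourierCoeff₂_exp_mul, sub_zero] at e1
    constructor
    · intro h0
      rw [h0, mul_zero] at e1
      exact (mul_eq_zero.1 e1).resolve_left (Complex.exp_ne_zero _)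
    · intro h0
      rw [h0, mul_zero] at e1
      exact (mul_eq_zero.1 e1.symm).resolve_left (Complex.exp_ne_zero _)
  have hm : ∀ n m, fourierCoeff₂ G n m = 0 ↔ fourierCoeff₂ G n (m - 2) = 0 := fun n m ↦ by
    have e1 := fourierCoeff₂_translate hG h1 h2 s' t' n m
    have e2 : (fun x y ↦ G (x + s') (y + t')) = fun x y ↦ Complex.exp c' *
        (Complex.exp (2 * Real.pi * Complex.I * ((0 : ℤ) * x + (2 : ℤ) * y)) * G x y) := by
      funext x y
      rw [h4, ← mul_assoc, ← Complex.exp_add]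
      congr 2
      push_cast
      ring
    rw [e2, fourierCoeff₂_const_mul, fourierCoeff₂_exp_mul, sub_zero] at e1
    constructor
    · intro h0
      rw [h0, mul_zero] at e1
      exact (mul_eq_zero.1 e1).resolve_left (Complex.exp_ne_zero _)
    · intro h0
      rw [h0, mul_zero] at e1
      exact (mul_eq_zero.1 e1.symm).resolve_left (Complex.exp_ne_zero _)
  have hall : ∀ n m, fourierCoeff₂ G n m = 0 := fun n m ↦
    forall_int_of_step_two (p := fun n ↦ fourierCoeff₂ G n m = 0)
      (forall_int_of_step_two (p := fun m ↦ fourierCoeff₂ G 0 m = 0)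
        (by simpa using h 0 0) (by simpa using h 0 1) (hm 0) m)
      (forall_int_of_step_two (p := fun m ↦ fourierCoeff₂ G 1 m = 0)
        (by simpa using h 1 0) (by simpa using h 1 1) (hm 1) m)
      (fun n ↦ hn n m) n
  have := eq_zero_of_fourierCoeff₂_eq_zero (G := fun u v ↦ G (u + x) (v + y))
    (hG.continuous.comp (by fun_prop : Continuous fun p : ℂ × ℂ ↦ (p.1 + x, p.2 + y)))
    (fun u v ↦ by rw [add_right_comm, h1]) (fun u v ↦ by rw [add_right_comm, h2])
    (fun n m ↦ by rw [fourierCoeff₂_translate hG h1 h2, hall, mul_zero]) 0 0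
  simpa using this

end Fourier

/-! ### The number of independent theta functions -/

namespace PrincipalPolarization

variable {V : Type*} [NormedAddCommGroup V] [NormedSpace ℂ V] {Λ : Submodule ℤ V}

/-- Pairing with a lattice vector, as an integral linear form on the lattice. -/
theorem exists_intForm (θ : PrincipalPolarization Λ) (m : Λ) :
    ∃ φ : Λ →ₗ[ℤ] ℤ, ∀ l : Λ, (φ l : ℝ) = θ.form m l := by
  have h : ∀ l : Λ, ∃ k : ℤ, θ.form m l = k := fun l ↦ θ.integral m m.2 l l.2
  choose k hk using h
  let φ : Λ →+ ℤ := AddMonoidHom.mk' k fun l l' ↦ by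
    have : ((k (l + l') : ℤ) : ℝ) = ((k l + k l' : ℤ) : ℝ) := by
      rw [Int.cast_add, ← hk, ← hk, ← hk, Submodule.coe_add, map_add]
    exact_mod_cast this
  exact ⟨φ.toIntLinearMap, fun l ↦ (hk l).symm⟩

/-- The part of a symplectic basis of the lattice which is needed: an isotropic pair of lattice
vectors together with a dual pair. -/
theorem exists_symplectic_vectors (θ : PrincipalPolarization Λ) (hV : Module.finrank ℂ V = 2)
    [DiscreteTopology Λ] [IsZLattice ℝ Λ] :
    ∃ a b : Fin 2 → Λ, θ.form (a 0) (a 1) = 0 ∧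
      ∀ i j, θ.form (a i) (b j) = if i = j then 1 else 0 := by
  have : FiniteDimensional ℂ V := Module.finite_of_finrank_pos (by omega)
  have : FiniteDimensional ℝ V := FiniteDimensional.complexToReal V
  have : Module.Free ℤ Λ := ZLattice.module_free ℝ Λ
  have : Module.Finite ℤ Λ := ZLattice.module_finite ℝ Λ
  have hV' : Module.finrank ℝ V = 4 := by rw [finrank_real_of_complex, hV]
  have hΛ : Module.finrank ℤ Λ = 4 := by rw [ZLattice.rank ℝ Λ, hV']
  have : Nontrivial Λ := Module.nontrivial_of_finrank_pos (R := ℤ) (by omega)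
  let B := Module.Free.chooseBasis ℤ Λ
  obtain ⟨i⟩ : Nonempty (Module.Free.ChooseBasisIndex ℤ Λ) := B.index_nonempty
  obtain ⟨b₀, hb₀Λ, hb₀⟩ := θ.unimodular (B.coord i)
  let a₀ : Λ := B i
  let b₀' : Λ := ⟨b₀, hb₀Λ⟩
  have hab : θ.form a₀ b₀ = 1 := by rw [hb₀]; simp [a₀]
  have hba : θ.form b₀ a₀ = -1 := by rw [θ.form_neg_swap, hab]
  obtain ⟨α, hα⟩ := θ.exists_intForm a₀
  obtain ⟨β, hβ⟩ := θ.exists_intForm b₀'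
  -- The orthogonal complement of the hyperbolic plane spanned by `a₀` and `b₀`.
  let M : Submodule ℤ Λ := LinearMap.ker α ⊓ LinearMap.ker β
  let pr : Λ →ₗ[ℤ] Λ := LinearMap.id - α.smulRight b₀' + β.smulRight a₀
  have hprα : ∀ x, α (pr x) = 0 := fun x ↦ by
    have h1 : (α (pr x) : ℝ) = 0 := by
      rw [hα]
      simp only [pr, LinearMap.add_apply, LinearMap.sub_apply, LinearMap.id_apply,
        LinearMap.smulRight_apply, Submodule.coe_add, Submodule.coe_sub, Submodule.coe_smul,
        map_add, map_sub, map_zsmul, θ.alt, smul_zero, add_zero]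
      rw [show ((b₀' : Λ) : V) = b₀ from rfl, hab, ← hα]
      simp
    exact_mod_cast h1
  have hprβ : ∀ x, β (pr x) = 0 := fun x ↦ by
    have h1 : (β (pr x) : ℝ) = 0 := by
      rw [hβ]
      simp only [pr, LinearMap.add_apply, LinearMap.sub_apply, LinearMap.id_apply,
        LinearMap.smulRight_apply, Submodule.coe_add, Submodule.coe_sub, Submodule.coe_smul,
        map_add, map_sub, map_zsmul, θ.alt, smul_zero, sub_zero]
      rw [show θ.form (b₀' : Λ) a₀ = -1 from hba, ← hβ]
      simp
    exact_mod_cast h1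
  have hprM : ∀ x, pr x ∈ M := fun x ↦ ⟨hprα x, hprβ x⟩
  have hMpr : ∀ x ∈ M, pr x = x := fun x hx ↦ by
    have h1 : α x = 0 := hx.1
    have h2 : β x = 0 := hx.2
    simp [pr, h1, h2]
  have hM : Nontrivial M := by
    by_contra hM
    rw [not_nontrivial_iff_subsingleton] at hM
    have hpr0 : ∀ x, pr x = 0 := fun x ↦ by
      have := congrArg Subtype.val (Subsingleton.elim (⟨pr x, hprM x⟩ : M) 0)
      simpa using this
    have hspan : ∀ x : Λ, x ∈ Submodule.span ℤ (Set.range ![a₀, b₀']) := fun x ↦ by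
      have h1 := hpr0 x
      simp only [pr, LinearMap.add_apply, LinearMap.sub_apply, LinearMap.id_apply,
        LinearMap.smulRight_apply] at h1
      have h2 : x = α x • b₀' - β x • a₀ := by
        rw [← sub_eq_zero, ← h1]; abel
      rw [h2]
      exact sub_mem (Submodule.smul_mem _ _ (Submodule.subset_span ⟨1, rfl⟩))
        (Submodule.smul_mem _ _ (Submodule.subset_span ⟨0, rfl⟩))
    have h2 := finrank_range_le_card (R := ℤ) ![a₀, b₀']
    rw [Set.finrank, (Submodule.eq_top_iff'.2 hspan), finrank_top, hΛ] at h2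
    simp at h2
  have : Module.Free ℤ M := inferInstance
  let BM := Module.Free.chooseBasis ℤ M
  obtain ⟨j⟩ : Nonempty (Module.Free.ChooseBasisIndex ℤ M) := BM.index_nonempty
  let a₁ : Λ := (BM j : M)
  have ha₁M : a₁ ∈ M := (BM j).2
  obtain ⟨b₁, hb₁Λ, hb₁⟩ := θ.unimodular ((BM.coord j).comp (pr.codRestrict M hprM))
  have h01 : θ.form a₀ a₁ = 0 := by
    rw [← hα, show α a₁ = 0 from ha₁M.1, Int.cast_zero]
  have h10 : θ.form a₁ b₀ = 0 := by
    rw [θ.form_neg_swap, show θ.form b₀ a₁ = (β a₁ : ℝ) from (hβ a₁).symm,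
      show β a₁ = 0 from ha₁M.2, Int.cast_zero, neg_zero]
  have h11 : θ.form a₁ b₁ = 1 := by
    rw [hb₁]
    have : pr.codRestrict M hprM a₁ = BM j := Subtype.ext (hMpr a₁ ha₁M)
    rw [LinearMap.comp_apply, this]
    simp
  have h0b₁ : θ.form a₀ b₁ = 0 := by
    rw [hb₁]
    have : pr.codRestrict M hprM a₀ = 0 := Subtype.ext (by
      have h1 : (α a₀ : ℝ) = 0 := by rw [hα, θ.alt]
      have h2 : (β a₀ : ℝ) = -1 := by rw [hβ]; exact hba
      have h1' : α a₀ = 0 := by exact_mod_cast h1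
      have h2' : β a₀ = -1 := by exact_mod_cast h2
      simp [pr, h1', h2'])
    rw [LinearMap.comp_apply, this]
    simp
  refine ⟨![a₀, a₁], ![b₀', ⟨b₁, hb₁Λ⟩], h01, fun i j ↦ ?_⟩
  fin_cases i <;> fin_cases j
  · exact hab
  · exact h0b₁
  · exact h10
  · exact h11

/-- An isotropic pair of vectors with a dual pair is linearly independent over `ℂ`: by positivity,
its real span contains no complex line. -/
theorem linearIndependent_of_isotropic (θ : PrincipalPolarization Λ) {a b : Fin 2 → V}
    (ha : θ.form (a 0) (a 1) = 0) (hab : ∀ i j, θ.form (a i) (b j) = if i = j then 1 else 0) :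
    LinearIndependent ℂ a := by
  have ha' : θ.form (a 1) (a 0) = 0 := by rw [θ.form_neg_swap, ha, neg_zero]
  have hzero : ∀ x : Fin 2 → ℝ, x 0 • a 0 + x 1 • a 1 = 0 → ∀ i, x i = 0 := fun x hx i ↦ by
    have h1 : θ.form (x 0 • a 0 + x 1 • a 1) (b i) = 0 := by rw [hx]; simp
    simp only [map_add, map_smul, LinearMap.add_apply, LinearMap.smul_apply, hab, smul_eq_mul] at h1
    fin_cases i <;> simpa using h1
  rw [Fintype.linearIndependent_iff]
  intro z hz
  rw [Fin.sum_univ_two] at hz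
  let c : V := (z 0).re • a 0 + (z 1).re • a 1
  let d : V := (z 0).im • a 0 + (z 1).im • a 1
  have hsplit : ∀ (w : ℂ) (x : V), w • x = w.re • x + Complex.I • (w.im • x) := fun w x ↦ by
    conv_lhs => rw [← Complex.re_add_im w]
    rw [add_smul, mul_comm, mul_smul, Complex.coe_smul, Complex.coe_smul]
  -- The relation says `c + i d = 0`; as `c` and `d` are orthogonal, positivity gives `d = 0`.
  have hcd : Complex.I • d = -c := by
    rw [eq_neg_iff_add_eq_zero, ← hz, hsplit (z 0), hsplit (z 1)]
    simp only [c, d, smul_add]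
    abel
  have hd : d = 0 := by
    by_contra hd
    have h1 := θ.pos d hd
    rw [hcd] at h1
    simp [c, d, θ.alt, ha, ha'] at h1
  have hc : c = 0 := by rw [hd, smul_zero] at hcd; exact neg_eq_zero.1 hcd.symm
  intro i
  exact Complex.ext (hzero (fun i ↦ (z i).re) hc i) (hzero (fun i ↦ (z i).im) hd i)

/-- A principal polarization `θ` of a complex torus of dimension two admits at most four linearly
independent theta functions of class `2θ`. After multiplication by the exponential of a quadratic
form these become the classical theta functions for a symplectic basis, which are determined by
four of their Fourier coefficients. -/
theorem finrank_thetaSpace_le (θ : PrincipalPolarization Λ) (hV : Module.finrank ℂ V = 2)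
    [DiscreteTopology Λ] [IsZLattice ℝ Λ] :
    Module.Finite ℂ θ.thetaSpace ∧ Module.finrank ℂ θ.thetaSpace ≤ 4 := by
  have : FiniteDimensional ℂ V := Module.finite_of_finrank_pos (by omega)
  obtain ⟨a, b, haa, hab⟩ := θ.exists_symplectic_vectors hV
  have hli : LinearIndependent ℂ fun i ↦ (a i : V) :=
    θ.linearIndependent_of_isotropic (b := fun i ↦ (b i : V)) haa hab
  let A : Module.Basis (Fin 2) ℂ V := basisOfLinearIndependentOfCardEqFinrank hli (by simp [hV])
  have hA : ∀ i, A i = a i := fun i ↦ by simp [A]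
  have hexp : ∀ v, v = A.coord 0 v • (a 0 : V) + A.coord 1 v • (a 1 : V) := fun v ↦ by
    have := A.sum_repr v
    rw [Fin.sum_univ_two, hA, hA] at this
    exact this.symm
  have hcoord : ∀ i j, A.coord i (a j) = if i = j then 1 else 0 := fun i j ↦ by
    rw [← hA, Module.Basis.coord_apply, Module.Basis.repr_self, Finsupp.single_apply]
    simp [eq_comm]
  have hsymm : ∀ i j, θ.herm (a i) (a j) = θ.herm (a j) (a i) := fun i j ↦ by
    have h1 : θ.form (a j) (a i) = 0 := by
      have h2 : θ.form (a 1) (a 0) = 0 := by rw [θ.form_neg_swap, haa, neg_zero]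
      fin_cases i <;> fin_cases j <;> simp [θ.alt, haa, h2]
    rw [← sub_eq_zero, θ.herm_sub_herm, h1]
    simp
  -- The symmetric `ℂ`-bilinear form which agrees with the Hermitian form on the span of `a`.
  let Q : V → V → ℂ := fun v w ↦ ∑ i, ∑ j, A.coord i v * A.coord j w * θ.herm (a j) (a i)
  have hQadd : ∀ v l, Q (v + l) (v + l) = Q v v + 2 * Q v l + Q l l := fun v l ↦ by
    simp only [Q, Fin.sum_univ_two, map_add, hsymm 1 0]
    ring
  -- Hence the factors of automorphy along `a` become trivial, and those along `b` become
  -- exponentials of the coordinates.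
  have hQa : ∀ v j, Q v (a j) = θ.herm (a j) v := fun v j ↦ by
    conv_rhs => rw [hexp v]
    simp only [Q, Fin.sum_univ_two, map_add, map_smul, smul_eq_mul, hcoord]
    fin_cases j <;> simp
  have hQb : ∀ v j, θ.herm (b j) v - Q v (b j) = 2 * Complex.I * A.coord j v := fun v j ↦ by
    have h1 : ∀ i, θ.herm (b j) (a i) - θ.herm (a i) (b j)
        = 2 * Complex.I * if i = j then 1 else 0 := fun i ↦ by
      rw [θ.herm_sub_herm, hab]
      split_ifs <;> simp
    have h2 : ∀ i, θ.herm (a i) (b j)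
        = A.coord 0 (b j : V) * θ.herm (a i) (a 0) + A.coord 1 (b j : V) * θ.herm (a i) (a 1) :=
      fun i ↦ by
        conv_lhs => rw [hexp (b j : V)]
        simp only [map_add, map_smul, smul_eq_mul]
    have h3 : θ.herm (b j) v
        = A.coord 0 v * θ.herm (b j) (a 0) + A.coord 1 v * θ.herm (b j) (a 1) := by
      conv_lhs => rw [hexp v]
      simp only [map_add, map_smul, smul_eq_mul]
    have h4 : 2 * Complex.I * A.coord j v = A.coord 0 v * (2 * Complex.I * if 0 = j then 1 else 0)
        + A.coord 1 v * (2 * Complex.I * if 1 = j then 1 else 0) := by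
      fin_cases j <;> simp <;> ring
    rw [h4, ← h1, ← h1, h2, h2, h3]
    simp only [Q, Fin.sum_univ_two, hsymm 0 1]
    ring
  -- The point of `V` with given coordinates, and the classical theta function of `ϕ`.
  let pt : ℂ → ℂ → V := fun x y ↦ x • (a 0 : V) + y • (a 1 : V)
  have hptd : Differentiable ℂ fun p : ℂ × ℂ ↦ pt p.1 p.2 := by
    simp only [pt]; fun_prop
  have hpt0 : ∀ x y, A.coord 0 (pt x y) = x := fun x y ↦ by
    simp only [pt, map_add, map_smul, hcoord]; simp
  have hpt1 : ∀ x y, A.coord 1 (pt x y) = y := fun x y ↦ by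
    simp only [pt, map_add, map_smul, hcoord]; simp
  have hpt : ∀ v, pt (A.coord 0 v) (A.coord 1 v) = v := fun v ↦ (hexp v).symm
  have hptadd : ∀ x y v, pt (x + A.coord 0 v) (y + A.coord 1 v) = pt x y + v := fun x y v ↦ by
    conv_rhs => rw [hexp v]
    simp only [pt, add_smul]
    abel
  let G : (V → ℂ) → ℂ → ℂ → ℂ := fun ϕ x y ↦
    Complex.exp (-(Real.pi * Q (pt x y) (pt x y))) * ϕ (pt x y)
  have hcoordd : ∀ i, Differentiable ℂ (A.coord i) := fun i ↦
    (LinearMap.toContinuousLinearMap (A.coord i)).differentiable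
  have hQd : Differentiable ℂ fun v ↦ Q v v := by
    simp only [Q, Fin.sum_univ_two]
    have := hcoordd 0
    have := hcoordd 1
    fun_prop
  have hGd : ∀ ϕ ∈ θ.thetaSpace, Differentiable ℂ fun p : ℂ × ℂ ↦ G ϕ p.1 p.2 := fun ϕ hϕ ↦
    (((hQd.comp hptd).const_mul _).neg.cexp).mul (hϕ.1.comp hptd)
  have hGl : ∀ ϕ ∈ θ.thetaSpace, ∀ (l : Λ) x y, G ϕ (x + A.coord 0 (l : V)) (y + A.coord 1 (l : V))
      = Complex.exp (2 * Real.pi * (θ.herm l (pt x y) - Q (pt x y) l)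
        + Real.pi * (θ.herm l l - Q l l)) * G ϕ x y := fun ϕ hϕ l x y ↦ by
    simp only [G]
    rw [hptadd, hϕ.2 l l.2, ← mul_assoc, ← mul_assoc, ← Complex.exp_add, ← Complex.exp_add, hQadd]
    congr 2
    ring
  have hGa : ∀ ϕ ∈ θ.thetaSpace, ∀ (j : Fin 2) x y,
      G ϕ (x + A.coord 0 (a j : V)) (y + A.coord 1 (a j : V)) = G ϕ x y := fun ϕ hϕ j x y ↦ by
    rw [hGl ϕ hϕ, hQa, hQa, sub_self, sub_self]
    simp
  have hGb : ∀ ϕ ∈ θ.thetaSpace, ∀ (j : Fin 2) x y,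
      G ϕ (x + A.coord 0 (b j : V)) (y + A.coord 1 (b j : V))
        = Complex.exp (4 * Real.pi * Complex.I * A.coord j (pt x y)
          + Real.pi * (θ.herm (b j) (b j) - Q (b j) (b j))) * G ϕ x y := fun ϕ hϕ j x y ↦ by
    rw [hGl ϕ hϕ, hQb]
    congr 2
    ring
  let L : θ.thetaSpace →ₗ[ℂ] (Fin 2 × Fin 2 → ℂ) :=
    { toFun := fun ϕ p ↦ fourierCoeff₂ (G ϕ) (p.1 : ℕ) (p.2 : ℕ)
      map_add' := fun ϕ ψ ↦ by
        funext p
        rw [Pi.add_apply, ← fourierCoeff₂_add (hGd ϕ ϕ.2).continuous (hGd ψ ψ.2).continuous]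
        congr 1
        funext x y
        simp only [G, Submodule.coe_add, Pi.add_apply, mul_add]
      map_smul' := fun c ϕ ↦ by
        funext p
        rw [Pi.smul_apply, RingHom.id_apply, smul_eq_mul, ← fourierCoeff₂_const_mul]
        congr 1
        funext x y
        simp only [G, Submodule.coe_smul, Pi.smul_apply, smul_eq_mul, mul_left_comm] }
  have hL : Function.Injective L := by
    rw [injective_iff_map_eq_zero]
    intro ϕ hϕ
    have h0 : ∀ x y, G ϕ x y = 0 := eq_zero_of_quasiperiodic (hGd ϕ ϕ.2)
      (fun x y ↦ by simpa [hcoord] using hGa ϕ ϕ.2 0 x y)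
      (fun x y ↦ by simpa [hcoord] using hGa ϕ ϕ.2 1 x y)
      (fun x y ↦ by rw [hGb ϕ ϕ.2 0 x y, hpt0])
      (fun x y ↦ by rw [hGb ϕ ϕ.2 1 x y, hpt1])
      (fun i j ↦ congrFun hϕ (i, j))
    refine Subtype.ext (funext fun v ↦ ?_)
    have h1 := h0 (A.coord 0 v) (A.coord 1 v)
    simp only [G, hpt] at h1
    exact (mul_eq_zero.1 h1).resolve_left (Complex.exp_ne_zero _)
  refine ⟨Module.Finite.of_injective L hL, ?_⟩
  simpa using LinearMap.finrank_le_finrank_of_injective hL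

end PrincipalPolarization

/-! ### Kummer surfaces are not planar -/

section Nonplanar

theorem eval_smul_of_isHomogeneous {σ : Type*} [Fintype σ] {F : MvPolynomial σ ℂ} {d : ℕ}
    (hF : F.IsHomogeneous d) (c : ℂ) (x : σ → ℂ) :
    MvPolynomial.eval (c • x) F = c ^ d * MvPolynomial.eval x F := by
  rw [MvPolynomial.eval_eq', MvPolynomial.eval_eq', Finset.mul_sum]
  refine Finset.sum_congr rfl fun m hm ↦ ?_
  have hd : ∑ i, m i = d := by
    rw [← hF (MvPolynomial.mem_support_iff.1 hm), Finsupp.weight_apply, Finsupp.sum_fintype]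
    · simp
    · simp
  simp only [Pi.smul_apply, smul_eq_mul, mul_pow, Finset.prod_mul_distrib,
    Finset.prod_pow_eq_pow_sum, hd]
  ring

theorem pderiv_comm {σ R : Type*} [CommRing R] (i j : σ) (F : MvPolynomial σ R) :
    MvPolynomial.pderiv i (MvPolynomial.pderiv j F)
      = MvPolynomial.pderiv j (MvPolynomial.pderiv i F) := by
  classical
  have h : ⁅MvPolynomial.pderiv i,
      (MvPolynomial.pderiv j : Derivation R (MvPolynomial σ R) _)⁆ = 0 :=
    MvPolynomial.derivation_ext fun k ↦ by
      rw [Derivation.commutator_apply, MvPolynomial.pderiv_X, MvPolynomial.pderiv_X]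
      simp only [Pi.single_apply]
      split_ifs <;> simp
  have h2 := congrArg (fun D ↦ D F) h
  simp only [Derivation.commutator_apply] at h2
  exact sub_eq_zero.1 h2

/-- The restriction of `F` to the line through `p` in the direction `q`. -/
noncomputable def restrictLine {σ : Type*} (p q : σ → ℂ) :
    MvPolynomial σ ℂ →ₐ[ℂ] Polynomial ℂ :=
  MvPolynomial.aeval fun i ↦ Polynomial.C (p i) + Polynomial.C (q i) * Polynomial.X

theorem eval_restrictLine {σ : Type*} (p q : σ → ℂ) (F : MvPolynomial σ ℂ) (t : ℂ) :
    (restrictLine p q F).eval t = MvPolynomial.eval (p + t • q) F := by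
  have h : (Polynomial.evalRingHom t).comp (restrictLine p q).toRingHom
      = (MvPolynomial.eval (p + t • q) : MvPolynomial σ ℂ →+* ℂ) := by
    refine MvPolynomial.ringHom_ext (fun c ↦ ?_) fun i ↦ ?_
    · simp [restrictLine]
    · simp only [restrictLine, RingHom.comp_apply, AlgHom.toRingHom_eq_coe, RingHom.coe_coe,
        MvPolynomial.aeval_X, Polynomial.coe_evalRingHom, Polynomial.eval_add, Polynomial.eval_mul,
        Polynomial.eval_C, Polynomial.eval_X, MvPolynomial.eval_X, Pi.add_apply, Pi.smul_apply,
        smul_eq_mul]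
      ring
  exact congrArg (fun φ ↦ φ F) h

theorem derivative_restrictLine {σ : Type*} [Fintype σ] (p q : σ → ℂ) (F : MvPolynomial σ ℂ) :
    Polynomial.derivative (restrictLine p q F)
      = ∑ i, Polynomial.C (q i) * restrictLine p q (MvPolynomial.pderiv i F) := by
  classical
  induction F using MvPolynomial.induction_on with
  | C c => simp [restrictLine]
  | add F G hF hG =>
    simp only [map_add, hF, hG, mul_add, Finset.sum_add_distrib]
  | mul_X F j hF =>
    simp only [map_mul, Polynomial.derivative_mul, hF, MvPolynomial.pderiv_mul, map_add, mul_add,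
      Finset.sum_add_distrib, Finset.sum_mul]
    congr 1
    · exact Finset.sum_congr rfl fun i _ ↦ by ring
    · rw [Finset.sum_eq_single j]
      · simp [restrictLine]; ring
      · intro i _ hij
        rw [MvPolynomial.pderiv_X_of_ne hij.symm]
        simp
      · simp

/-- If a hypersurface of degree at least three is contained in a hyperplane as a set, then its
equation vanishes to second order along it: on a line through a point `p` of the hypersurface which
leaves the hyperplane, the equation vanishes only at `p`, hence is a monomial. -/
theorem hessian_form_eq_zero_of_planar {n d : ℕ} (hd : 3 ≤ d) {F : MvPolynomial (Fin n) ℂ}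
    (hF : F.IsHomogeneous d) (ℓ : (Fin n → ℂ) →ₗ[ℂ] ℂ)
    (hplanar : ∀ x, MvPolynomial.eval x F = 0 → ℓ x = 0) {p : Fin n → ℂ}
    (hp : MvPolynomial.eval p F = 0) {q : Fin n → ℂ} (hq : ℓ q ≠ 0) :
    ∑ i, ∑ j, q i * q j *
      MvPolynomial.eval p (MvPolynomial.pderiv i (MvPolynomial.pderiv j F)) = 0 := by
  have hℓp : ℓ p = 0 := hplanar p hp
  have hconst : ∀ s : ℂ, MvPolynomial.eval (q + s • p) F = MvPolynomial.eval q F := by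
    have hdeg : (restrictLine q p F).degree ≤ 0 := by
      by_contra hdeg
      obtain ⟨s, hs⟩ := IsAlgClosed.exists_root (restrictLine q p F) (by
        intro h; exact hdeg h.le)
      rw [Polynomial.IsRoot.def, eval_restrictLine] at hs
      have := hplanar _ hs
      rw [map_add, map_smul, hℓp, smul_zero, add_zero] at this
      exact hq this
    intro s
    have h0 := eval_restrictLine q p F 0
    rw [zero_smul, add_zero] at h0
    rw [← eval_restrictLine, ← h0, Polynomial.eq_C_of_degree_le_zero hdeg]
    simp
  have hmon : restrictLine p q F = Polynomial.C (MvPolynomial.eval q F) * Polynomial.X ^ d := by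
    refine Polynomial.funext fun t ↦ ?_
    rw [eval_restrictLine]
    rcases eq_or_ne t 0 with rfl | ht
    · simp [hp, show d ≠ 0 by omega]
    · have h1 : p + t • q = t • (q + t⁻¹ • p) := by
        rw [smul_add, smul_smul, mul_inv_cancel₀ ht, one_smul, add_comm]
      rw [h1, eval_smul_of_isHomogeneous hF, hconst]
      simp only [Polynomial.eval_mul, Polynomial.eval_C, Polynomial.eval_pow, Polynomial.eval_X]
      ring
  have h2 := congrArg (fun P ↦ (Polynomial.derivative (Polynomial.derivative P)).eval 0) hmon
  simp only [derivative_restrictLine, Polynomial.derivative_sum, Polynomial.derivative_mul,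
    Polynomial.derivative_C, zero_mul, zero_add, Polynomial.eval_finsetSum, Polynomial.eval_mul,
    Polynomial.eval_C, Polynomial.derivative_X_pow, eval_restrictLine, zero_smul, add_zero,
    Polynomial.eval_pow, Polynomial.eval_X] at h2
  rw [zero_pow (show d - 1 - 1 ≠ 0 by omega), mul_zero, mul_zero, mul_zero] at h2
  rw [Finset.sum_comm, ← h2]
  refine Finset.sum_congr rfl fun j _ ↦ ?_
  rw [Finset.mul_sum]
  exact Finset.sum_congr rfl fun i _ ↦ by ring

/-- A quadratic form which vanishes off a hyperplane is zero. -/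
theorem eq_zero_of_form_eq_zero_off_hyperplane {ι : Type*} [Fintype ι] [DecidableEq ι]
    {M : Matrix ι ι ℂ} (hM : M.IsSymm) {ℓ : (ι → ℂ) →ₗ[ℂ] ℂ} (hℓ : ℓ ≠ 0)
    (h : ∀ q, ℓ q ≠ 0 → q ⬝ᵥ M.mulVec q = 0) : M = 0 := by
  obtain ⟨q₀, hq₀⟩ : ∃ q, ℓ q ≠ 0 := by
    by_contra! h0
    exact hℓ (LinearMap.ext h0)
  have hall : ∀ q, q ⬝ᵥ M.mulVec q = 0 := fun q ↦ by
    by_cases hq : ℓ q = 0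
    · have h1 := h (q + q₀) (by rw [map_add, hq, zero_add]; exact hq₀)
      have h2 := h (q - q₀) (by rw [map_sub, hq, zero_sub]; exact neg_ne_zero.2 hq₀)
      have h3 := h q₀ hq₀
      simp only [Matrix.mulVec_add, Matrix.mulVec_sub, add_dotProduct, sub_dotProduct,
        dotProduct_add, dotProduct_sub] at h1 h2
      linear_combination (1 / 2 : ℂ) * (h1 + h2) - h3
    · exact h q hq
  have hentry : ∀ i j, Pi.single i 1 ⬝ᵥ M.mulVec (Pi.single j 1) = M i j := fun i j ↦ by simp
  ext i j
  have h1 := hall (Pi.single i 1 + Pi.single j 1)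
  simp only [Matrix.mulVec_add, add_dotProduct, dotProduct_add, hentry] at h1
  have h2 := hall (Pi.single i 1)
  have h3 := hall (Pi.single j 1)
  rw [hentry] at h2 h3
  have h4 : M j i = M i j := hM.apply i j
  rw [Matrix.zero_apply]
  linear_combination (1 / 2 : ℂ) * (h1 - h2 - h3 - h4)

/-- A Kummer surface is not contained in a plane. -/
theorem IsKummerSurface.not_planar {S : Set (ProjSpace 3)} (hS : IsKummerSurface S)
    (ℓ : (Fin 4 → ℂ) →ₗ[ℂ] ℂ) (h : ∀ p ∈ S, ℓ p.rep = 0) : ℓ = 0 := by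
  obtain ⟨F, hF, rfl, hcard, hnode⟩ := hS
  by_contra hℓ
  have hplanar : ∀ x, MvPolynomial.eval x F = 0 → ℓ x = 0 := fun x hx ↦ by
    rcases eq_or_ne x 0 with rfl | hx0
    · exact map_zero ℓ
    · obtain ⟨a, ha⟩ := Projectivization.exists_smul_eq_mk_rep ℂ x hx0
      rw [Units.smul_def] at ha
      have h1 := h (Projectivization.mk ℂ x hx0) (by
        change MvPolynomial.eval _ F = 0
        rw [← ha, eval_smul_of_isHomogeneous hF, hx, mul_zero])
      rw [← ha, map_smul, smul_eq_mul] at h1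
      exact (mul_eq_zero.1 h1).resolve_left a.ne_zero
  obtain ⟨p, hp⟩ : (singularLocus F).Nonempty := by
    rw [Set.nonempty_iff_ne_empty]
    intro h0
    rw [h0, Set.ncard_empty] at hcard
    omega
  have hM : hessian F p = 0 := by
    refine eq_zero_of_form_eq_zero_off_hyperplane (Matrix.IsSymm.ext fun i j ↦ ?_) hℓ fun q hq ↦ ?_
    · simp only [hessian, Matrix.of_apply]
      rw [pderiv_comm]
    · rw [← hessian_form_eq_zero_of_planar (by norm_num) hF ℓ hplanar hp.1 hq]
      simp only [dotProduct, Matrix.mulVec, hessian, Matrix.of_apply, Finset.mul_sum]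
      exact Finset.sum_congr rfl fun i _ ↦ Finset.sum_congr rfl fun j _ ↦ by ring
  have hrank := (hnode p hp).2
  rw [hM, Matrix.rank_zero] at hrank
  omega

/-- The homogeneous coordinates of a covering of a Kummer surface are linearly independent. -/
theorem IsKummerSurface.linearIndependent_lift {V : Type*} [NormedAddCommGroup V]
    [NormedSpace ℂ V] {Λ : Submodule ℤ V} {S : Set (ProjSpace 3)} (hS : IsKummerSurface S)
    {π : V ⧸ Λ → ProjSpace 3} (hπ : Set.range π = S) {Ψ : V → Fin 4 → ℂ}
    (hΨ : IsLiftOn π Set.univ Ψ) : LinearIndependent ℂ fun i v ↦ Ψ v i := by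
  rw [Fintype.linearIndependent_iff]
  intro c hc
  have hℓ := hS.not_planar (∑ i, c i • LinearMap.proj i) (fun p hp ↦ by
    rw [← hπ] at hp
    obtain ⟨x, rfl⟩ := hp
    obtain ⟨v, rfl⟩ := Submodule.Quotient.mk_surjective Λ x
    obtain ⟨h0, h1⟩ := hΨ v trivial
    obtain ⟨a, ha⟩ := Projectivization.exists_smul_eq_mk_rep ℂ (Ψ v) h0
    rw [h1, ← ha, Units.smul_def, map_smul]
    have h2 := congrFun hc v
    simp only [Finset.sum_apply, Pi.smul_apply, smul_eq_mul, Pi.zero_apply] at h2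
    simp [LinearMap.sum_apply, h2])
  intro i
  have := LinearMap.congr_fun hℓ (Pi.single i 1)
  simpa [LinearMap.sum_apply, Pi.single_apply] using this

end Nonplanar

/-! ### Comparison of two coverings -/

section Comparison

variable {V : Type*} [NormedAddCommGroup V] [NormedSpace ℂ V] {V' : Type*} [NormedAddCommGroup V']
  [NormedSpace ℂ V'] {Λ : Submodule ℤ V} {Λ' : Submodule ℤ V'}

/-- Isomorphisms of principally polarized tori pull back theta functions to theta functions. -/
theorem PrincipalPolarization.comp_mem_thetaSpace [FiniteDimensional ℂ V]
    {θ : PrincipalPolarization Λ} {θ' : PrincipalPolarization Λ'} (g : V ≃ₗ[ℂ] V')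
    (hg : ∀ v, g v ∈ Λ' ↔ v ∈ Λ) (hθ : ∀ v w, θ'.form (g v) (g w) = θ.form v w) {ϕ : V' → ℂ}
    (hϕ : ϕ ∈ θ'.thetaSpace) : (fun v ↦ ϕ (g v)) ∈ θ.thetaSpace := by
  have hherm : ∀ v w, θ'.herm (g w) (g v) = θ.herm w v := fun v w ↦ by
    rw [θ'.herm_apply, θ.herm_apply, ← map_smul, hθ, hθ]
  refine ⟨hϕ.1.comp (LinearMap.toContinuousLinearMap (g : V →ₗ[ℂ] V')).differentiable,
    fun l hl v ↦ ?_⟩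
  simp only
  rw [map_add, hϕ.2 _ ((hg l).2 hl), hherm, hherm]

/-- Two linearly independent systems of vectors, with as many members as the dimension, differ by
an invertible matrix. -/
theorem exists_linearEquiv_of_linearIndependent {X : Type*} {n : ℕ} (W : Submodule ℂ (X → ℂ))
    [Module.Finite ℂ W] (hW : Module.finrank ℂ W ≤ n) {Ψ Ψ' : X → Fin n → ℂ}
    (hΨ : ∀ i, (fun v ↦ Ψ v i) ∈ W) (hΨ' : ∀ i, (fun v ↦ Ψ' v i) ∈ W)
    (hli : LinearIndependent ℂ fun i v ↦ Ψ v i) (hli' : LinearIndependent ℂ fun i v ↦ Ψ' v i) :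
    ∃ T : (Fin n → ℂ) ≃ₗ[ℂ] (Fin n → ℂ), ∀ v, T (Ψ v) = Ψ' v := by
  have hlift : ∀ {Ψ : X → Fin n → ℂ} (hΨ : ∀ i, (fun v ↦ Ψ v i) ∈ W),
      LinearIndependent ℂ (fun i v ↦ Ψ v i) →
      LinearIndependent ℂ fun i ↦ (⟨fun v ↦ Ψ v i, hΨ i⟩ : W) := fun hΨ h ↦
    LinearIndependent.of_comp W.subtype h
  have hdim : Fintype.card (Fin n) = Module.finrank ℂ W :=
    le_antisymm (hlift hΨ hli).fintype_card_le_finrank (by simpa using hW)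
  rcases isEmpty_or_nonempty (Fin n) with hn | hn
  · exact ⟨LinearEquiv.refl _ _, fun v ↦ Subsingleton.elim _ _⟩
  let B := basisOfLinearIndependentOfCardEqFinrank (hlift hΨ hli) hdim
  let B' := basisOfLinearIndependentOfCardEqFinrank (hlift hΨ' hli') hdim
  have hB : ∀ i, B i = ⟨fun v ↦ Ψ v i, hΨ i⟩ := fun i ↦ by simp [B]
  have hB' : ∀ i, B' i = ⟨fun v ↦ Ψ' v i, hΨ' i⟩ := fun i ↦ by simp [B']
  refine ⟨Matrix.toLin'OfInv (M := (B'.toMatrix B).transpose) (M' := (B.toMatrix B').transpose)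
    ?_ ?_, fun v ↦ ?_⟩
  · rw [← Matrix.transpose_mul, Module.Basis.toMatrix_mul_toMatrix_flip, Matrix.transpose_one]
  · rw [← Matrix.transpose_mul, Module.Basis.toMatrix_mul_toMatrix_flip, Matrix.transpose_one]
  · funext i
    change ((B.toMatrix B').transpose.mulVec (Ψ v)) i = Ψ' v i
    have h1 := congrArg (fun ψ : W ↦ (ψ : X → ℂ) v) (B.sum_toMatrix_smul_self B' i)
    simp only [Submodule.coe_sum, Finset.sum_apply, Submodule.coe_smul, Pi.smul_apply, hB, hB',
      smul_eq_mul] at h1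
    rw [← h1]
    rfl

end Comparison

end KummerSurface

theorem mainTheorem12
    {V : Type*} [NormedAddCommGroup V] [NormedSpace ℂ V] (hV : Module.finrank ℂ V = 2)
    {V' : Type*} [NormedAddCommGroup V'] [NormedSpace ℂ V'] (hV' : Module.finrank ℂ V' = 2)
    (Λ : Submodule ℤ V) [DiscreteTopology Λ] [IsZLattice ℝ Λ]
    (Λ' : Submodule ℤ V') [DiscreteTopology Λ'] [IsZLattice ℝ Λ']
    (S S' : Set (KummerSurface.ProjSpace 3))
    (hS : KummerSurface.IsKummerSurface S) (hS' : KummerSurface.IsKummerSurface S')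
    (π : V ⧸ Λ → KummerSurface.ProjSpace 3) (hπ : KummerSurface.IsKummerCovering π S)
    (π' : V' ⧸ Λ' → KummerSurface.ProjSpace 3) (hπ' : KummerSurface.IsKummerCovering π' S')
    (θ : KummerSurface.PrincipalPolarization Λ)
    (hθ : KummerSurface.PullbackO1HasClass π ((2 : ℝ) • θ.form))
    (θ' : KummerSurface.PrincipalPolarization Λ')
    (hθ' : KummerSurface.PullbackO1HasClass π' ((2 : ℝ) • θ'.form))
    (hiso : θ.Isomorphic θ') :
    KummerSurface.ProjectivelyEquivalent S S' := by
  have : FiniteDimensional ℂ V := Module.finite_of_finrank_pos (by omega)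
  have : FiniteDimensional ℂ V' := Module.finite_of_finrank_pos (by omega)
  obtain ⟨g, hgΛ, hgθ⟩ := hiso
  obtain ⟨Ψ, hΨ, hlift⟩ := KummerSurface.exists_lift_mem_thetaSpace θ π
    (fun x ↦ (hπ.fibre _ _).2 (Or.inr rfl)) hθ
  obtain ⟨Ψ', hΨ', hlift'⟩ := KummerSurface.exists_lift_mem_thetaSpace θ' π'
    (fun x ↦ (hπ'.fibre _ _).2 (Or.inr rfl)) hθ'
  have hli := hS.linearIndependent_lift hπ.range_eq hlift
  have hli' := hS'.linearIndependent_lift hπ'.range_eq hlift'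
  have hli'' : LinearIndependent ℂ fun i v ↦ Ψ' (g v) i :=
    hli'.map' (LinearMap.funLeft ℂ ℂ g)
      (LinearMap.ker_eq_bot.2 (LinearMap.funLeft_injective_of_surjective ℂ ℂ g g.surjective))
  obtain ⟨hfin, hdim⟩ := θ.finrank_thetaSpace_le hV
  obtain ⟨T, hT⟩ := KummerSurface.exists_linearEquiv_of_linearIndependent θ.thetaSpace hdim
    (Ψ' := fun v ↦ Ψ' (g v)) hΨ
    (fun i ↦ KummerSurface.PrincipalPolarization.comp_mem_thetaSpace g hgΛ hgθ (hΨ' i)) hli hli''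
  have hmap : ∀ v : V, Projectivization.map T.toLinearMap T.injective
      (π (Submodule.Quotient.mk v)) = π' (Submodule.Quotient.mk (g v)) := fun v ↦ by
    obtain ⟨h0, h1⟩ := hlift v trivial
    obtain ⟨h0', h1'⟩ := hlift' (g v) trivial
    rw [h1, h1', Projectivization.map_mk]
    congr 1
    exact hT v
  refine ⟨T, Set.Subset.antisymm ?_ ?_⟩
  · rintro _ ⟨p, hp, rfl⟩
    rw [← hπ.range_eq] at hp
    obtain ⟨x, rfl⟩ := hp
    obtain ⟨v, rfl⟩ := Submodule.Quotient.mk_surjective Λ x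
    rw [hmap, ← hπ'.range_eq]
    exact ⟨_, rfl⟩
  · intro p hp
    rw [← hπ'.range_eq] at hp
    obtain ⟨x, rfl⟩ := hp
    obtain ⟨v, rfl⟩ := Submodule.Quotient.mk_surjective Λ' x
    refine ⟨π (Submodule.Quotient.mk (g.symm v)), ?_, ?_⟩
    · rw [← hπ.range_eq]
      exact ⟨_, rfl⟩
    · rw [hmap, g.apply_symm_apply]
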